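/- **Setting.** For a finite group $G$ and a commutative ring $R$, let $\mathrm B_R(G,G)$ be the double Burnside $R$-algebra: the $R$-module freely generated by the isomorphism classes of finite $(G,G)$-bisets modulo the relations $[M\sqcup N]=[M]+[N]$, with multiplication $[M]\cdot[N]=[M\times_G N]$, where $M\times_G N$ is the set of orbits of $G$ on $M\times N$ under $g(m,n)=(mg^{-1},gn)$. Let $G=S_3$, let $R=\mathbf Z_{(3)}\subseteq\mathbf Q$ be the localization of $\mathbf Z$ at $(3)$, and write $\mathrm B_R:=\mathrm B_R(S_3,S_3)$, $\mathrm B_{\mathbf Z}:=\mathrm B_{\mathbf Z}(S_3,S_3)$, $\mathrm B_{\mathbf Q}:=\mathrm B_{\mathbf Q}(S_3,S_3)$. *The algebra $A$.* Let $\mathbf Q[\overline\eta,\overline\xi]:=\mathbf Q[\eta,\xi]/(\eta^2,\eta\xi,\xi^2)$ and let $A$ be the $\mathbf Q$-algebra of arrays $$\left[\begin{array}{cccccc} s_{1,1}&s_{1,2}&s_{1,3}&0&0&t_1\\ s_{2,1}&s_{2,2}&s_{2,3}&0&0&t_2\\ s_{3,1}&s_{3,2}&s_{3,3}&0&0&t_3\\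 0&0&0&u&0&v\\ 0&0&0&0&w&0\\ x_1&x_2&x_3&y&0&z_1+z_2\overline\eta+z_3\overline\xi\end{array}\right],$$ with $s_{i,j},t_i,u,v,w,x_i,y,z_i\in\mathbf Q$. We write such an element as $(s,t,u,v,w,x,y,z)$ with $s\in\mathbf Q^{3\times3}$, $t$ a column, $x$ a row and $z=z_1+z_2\overline\eta+z_3\overline\xi$. The addition is entrywise and the multiplication is $$(s,t,u,v,w,x,y,z)(s',t',u',v',w',x',y',z')=\bigl(ss',\ st'+tz_1',\ uu',\ uv'+vz_1',\ ww',\ xs'+z_1x',\ yu'+z_1y',\ xt'\,\overline\eta+yv'(\overline\xi-12\overline\eta)+zz'\bigr).$$ Let $A_R\subseteq A$ be the subset of the elements with all $s_{i,j},t_i,u,v,w,x_i,y,z_i$ in $R$; it is an $R$-subalgebra of $A$. *The map $\gamma$.* In $S_3$ let $a=(1,2)$, $b=(1,2,3)$, $V_0=1$, $V_1=\langle a\rangle$, $V_4=\langle b\rangle$, $V_5=S_3$. For $U\le S_3\times S_3$ regard $(S_3\times S_3)/U$ as a biset by $h\cdot y\cdot g=(h,g^{-1})y$. Let $H_{i,j}=[(S_3\times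 S_3)/(V_i\times V_j)]$ and $H^\Delta_i=[(S_3\times S_3)/\{(v,v):v\in V_i\}]$, and let $H_6,H_7,H_8$ be the classes of $(S_3\times S_3)/U$ for $U=\langle(a,a),(1,b)\rangle$, $\langle(a,a),(b,1)\rangle$, $\langle(a,a),(b,1),(1,b)\rangle$, respectively. Define the following elements of $\mathrm B_{\mathbf Q}$. - $e := -\tfrac{1}{2}H_{0,0}+H_{1,0}+\tfrac{1}{2}H_{4,0}$ - $b_{e,g} := \tfrac{1}{2}H_{0,0}-H_{1,0}-\tfrac{1}{2}H_{0,1}-\tfrac{1}{2}H_{4,0}+H_{1,1}+\tfrac{1}{2}H_{4,1}$ - $b_{e,h} := -\tfrac{1}{8}H_{0,0}+\tfrac{1}{4}H_{1,0}+\tfrac{1}{2}H_{0,1}+\tfrac{1}{8}H_{4,0}-\tfrac{3}{8}H_{0,4}-H_{1,1}-\tfrac{1}{2}H_{4,1}+\tfrac{3}{4}H_{1,4}+\tfrac{3}{8}H_{4,4}$ - $b_{g,e} := -\tfrac{4}{3}H_{0,0}+2H_{1,0}+H_{4,0}$ - $g := \tfrac{4}{3}H_{0,0}-2H_{1,0}-\tfrac{4}{3}H_{0,1}-H_{4,0}+2H_{1,1}+H_{4,1}$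 - $b_{g,h} := -\tfrac{1}{3}H_{0,0}+\tfrac{1}{2}H_{1,0}+\tfrac{4}{3}H_{0,1}+\tfrac{1}{4}H_{4,0}-H_{0,4}-2H_{1,1}-H_{4,1}+\tfrac{3}{2}H_{1,4}+\tfrac{3}{4}H_{4,4}$ - $b_{h,e} := -\tfrac{1}{3}H_{0,0}+H_{4,0}$ - $b_{h,g} := \tfrac{1}{3}H_{0,0}-\tfrac{1}{3}H_{0,1}-H_{4,0}+H_{4,1}$ - $h := -\tfrac{1}{12}H_{0,0}+\tfrac{1}{3}H_{0,1}+\tfrac{1}{4}H_{4,0}-\tfrac{1}{4}H_{0,4}-H_{4,1}+\tfrac{3}{4}H_{4,4}$ - $b_{e,\varepsilon_4} := -\tfrac{1}{8}H_{0,0}+\tfrac{1}{4}H_{1,0}+\tfrac{1}{4}H_{0,1}+\tfrac{1}{8}H_{4,0}+\tfrac{1}{8}H_{0,4}-\tfrac{1}{2}H_{1,1}-\tfrac{1}{4}H_{0,5}-\tfrac{1}{4}H_{4,1}-\tfrac{1}{4}H_{1,4}-\tfrac{1}{8}H_{4,4}+\tfrac{1}{2}H_{1,5}+\tfrac{1}{4}H_{4,5}$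 - $b_{g,\varepsilon_4} := -\tfrac{1}{3}H_{0,0}+\tfrac{1}{2}H_{1,0}+\tfrac{2}{3}H_{0,1}+\tfrac{1}{4}H_{4,0}+\tfrac{1}{3}H_{0,4}-H_{1,1}-\tfrac{2}{3}H_{0,5}-\tfrac{1}{2}H_{4,1}-\tfrac{1}{2}H_{1,4}-\tfrac{1}{4}H_{4,4}+H_{1,5}+\tfrac{1}{2}H_{4,5}$ - $b_{h,\varepsilon_4} := -\tfrac{1}{12}H_{0,0}+\tfrac{1}{6}H_{0,1}+\tfrac{1}{4}H_{4,0}+\tfrac{1}{12}H_{0,4}-\tfrac{1}{6}H_{0,5}-\tfrac{1}{2}H_{4,1}-\tfrac{1}{4}H_{4,4}+\tfrac{1}{2}H_{4,5}$ - $\varepsilon_2 := -H_{0,0}+H_{1,0}+H_{0,1}+H^\Delta_1-2H_{1,1}$ - $b_{\varepsilon_2,\varepsilon_4} := -\tfrac{1}{2}H_{0,0}+\tfrac{1}{2}H_{1,0}+\tfrac{1}{2}H_{0,1}+\tfrac{1}{2}H^\Delta_1+\tfrac{1}{2}H_{0,4}-H_{1,1}-\tfrac{1}{2}H_{0,5}-\tfrac{1}{2}H_6-\tfrac{1}{2}H_{1,4}+H_{1,5}$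 - $\varepsilon_3 := -\tfrac{1}{4}H_{0,0}+\tfrac{1}{4}H_{4,0}+\tfrac{1}{4}H_{0,4}+\tfrac{1}{2}H^\Delta_4-\tfrac{3}{4}H_{4,4}$ - $b_{\varepsilon_4,e} := \tfrac{1}{6}H_{0,0}-\tfrac{1}{3}H_{1,0}-\tfrac{1}{6}H_{4,0}+\tfrac{1}{3}H_{5,0}$ - $b_{\varepsilon_4,g} := -\tfrac{1}{6}H_{0,0}+\tfrac{1}{3}H_{1,0}+\tfrac{1}{6}H_{0,1}+\tfrac{1}{6}H_{4,0}-\tfrac{1}{3}H_{1,1}-\tfrac{1}{3}H_{5,0}-\tfrac{1}{6}H_{4,1}+\tfrac{1}{3}H_{5,1}$ - $b_{\varepsilon_4,h} := \tfrac{1}{24}H_{0,0}-\tfrac{1}{12}H_{1,0}-\tfrac{1}{6}H_{0,1}-\tfrac{1}{24}H_{4,0}+\tfrac{1}{8}H_{0,4}+\tfrac{1}{3}H_{1,1}+\tfrac{1}{12}H_{5,0}+\tfrac{1}{6}H_{4,1}-\tfrac{1}{4}H_{1,4}-\tfrac{1}{8}H_{4,4}-\tfrac{1}{3}H_{5,1}+\tfrac{1}{4}H_{5,4}$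 - $b_{\varepsilon_4,\varepsilon_2} := -\tfrac{1}{2}H_{0,0}+\tfrac{1}{2}H_{1,0}+\tfrac{1}{2}H_{0,1}+\tfrac{1}{2}H^\Delta_1+\tfrac{1}{2}H_{4,0}-H_{1,1}-\tfrac{1}{2}H_{5,0}-\tfrac{1}{2}H_{4,1}-\tfrac{1}{2}H_7+H_{5,1}$ - $\varepsilon_4 := \tfrac{1}{2}H_{0,0}-H^\Delta_1-\tfrac{1}{2}H^\Delta_4+H^\Delta_5$ - $b'_{\varepsilon_4,\varepsilon_4} := \tfrac{1}{24}H_{0,0}-\tfrac{1}{12}H_{1,0}-\tfrac{1}{12}H_{0,1}-\tfrac{1}{24}H_{4,0}-\tfrac{1}{24}H_{0,4}+\tfrac{1}{6}H_{1,1}+\tfrac{1}{12}H_{5,0}+\tfrac{1}{12}H_{0,5}+\tfrac{1}{12}H_{4,1}+\tfrac{1}{12}H_{1,4}+\tfrac{1}{24}H_{4,4}-\tfrac{1}{6}H_{1,5}-\tfrac{1}{6}H_{5,1}-\tfrac{1}{12}H_{4,5}-\tfrac{1}{12}H_{5,4}+\tfrac{1}{6}H_{5,5}$ - $b''_{\varepsilon_4,\varepsilon_4}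 := \tfrac{1}{4}H_{0,0}-\tfrac{3}{4}H_{1,0}-\tfrac{3}{4}H_{0,1}+\tfrac{1}{4}H^\Delta_1-\tfrac{1}{4}H_{4,0}-\tfrac{1}{4}H_{0,4}+\tfrac{3}{2}H_{1,1}+\tfrac{3}{4}H_{5,0}+\tfrac{3}{4}H_{0,5}-\tfrac{1}{4}H_6+\tfrac{3}{4}H_{4,1}+\tfrac{3}{4}H_{1,4}-\tfrac{1}{4}H_7+\tfrac{1}{4}H_{4,4}-\tfrac{3}{2}H_{1,5}-\tfrac{3}{2}H_{5,1}-\tfrac{3}{4}H_{4,5}-\tfrac{3}{4}H_{5,4}+\tfrac{1}{4}H_8+\tfrac{3}{2}H_{5,5}$ Let $\gamma:A\to\mathrm B_{\mathbf Q}$ be the map that sends the above array to $$\begin{aligned}&s_{1,1}e+s_{1,2}b_{e,g}+s_{1,3}b_{e,h}+s_{2,1}b_{g,e}+s_{2,2}g+s_{2,3}b_{g,h}+s_{3,1}b_{h,e}+s_{3,2}b_{h,g}+s_{3,3}h\\&+t_1b_{e,\varepsilon_4}+t_2b_{g,\varepsilon_4}+t_3b_{h,\varepsilon_4}+u\varepsilon_2+vb_{\varepsilon_2,\varepsilon_4}+w\varepsilon_3+x_1b_{\varepsilon_4,e}+x_2b_{\varepsilon_4,g}+x_3b_{\varepsilon_4,h}\\&+yb_{\varepsilon_4,\varepsilon_2}+z_1\varepsilon_4+z_2b'_{\varepsilon_4,\varepsilon_4}+z_3b''_{\varepsilon_4,\varepsilon_4}.\end{aligned}$$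 *The units.* Let $c_1,c_2,c_3$ be the units of $A$ that agree with $1_A=(1,0,1,0,1,0,0,1)$ except that $$c_1\text{ has } s=\begin{pmatrix}0&-2&0\\6&6&-4\\0&0&1\end{pmatrix},\qquad c_2\text{ has } s=\begin{pmatrix}1&0&0\\0&1&0\\0&7&1\end{pmatrix},\qquad c_3\text{ has } t=\begin{pmatrix}0\\0\\1\end{pmatrix},\ x=\begin{pmatrix}0&0&6\end{pmatrix}.$$ **Statement.** The map $\gamma$ is an isomorphism of $\mathbf Q$-algebras. Hence there is the ring morphism $\delta:\mathrm B_{\mathbf Z}\to A$, $\ y\mapsto c_3^{-1}c_2^{-1}c_1^{-1}\,\gamma^{-1}(y)\,c_1c_2c_3$ (where $\gamma^{-1}$ is applied to the image of $y$ in $\mathrm B_{\mathbf Q}$). Let $\Lambda:=\delta(\mathrm B_{\mathbf Z})$ and let $\Lambda_{(3)}:=R\Lambda\subseteq A$ be its localization at $3$, i.e. the $R$-linear span of $\Lambda$ in $A$, which is an $R$-subalgebra of $A$. Then $$\Lambda_{(3)}=\bigl\{(s,t,u,v,w,x,y,z)\in A_R\ :\ x_1\equiv x_2\equiv x_3\equiv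 z_2\equiv 0 \bmod 3R\bigr\}\subseteq A_R .$$ Moreover, $\mathrm B_R(S_3,S_3)\cong\Lambda_{(3)}$ as $R$-algebras, via an isomorphism that maps $[M]$ to $\delta([M])$ for every finite $(S_3,S_3)$-biset $M$. -/

import Mathlib

noncomputable section

/-! ### Finite bisets -/

/-- A finite `(G, G)`-biset: a finite set with commuting left and right `G`-actions.
A right action of `G` is an action of the opposite group `Gᵐᵒᵖ`. -/
structure Biset (G : Type) [Group G] where
  carrier : Type
  [finite : Finite carrier]
  [left : MulAction G carrier]
  [right : MulAction Gᵐᵒᵖ carrier]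
  [comm : SMulCommClass G Gᵐᵒᵖ carrier]

namespace Biset

attribute [instance] Biset.finite Biset.left Biset.right Biset.comm

variable {G : Type} [Group G]

/-- Isomorphism of bisets: a bijection compatible with both actions. -/
def Iso (M N : Biset G) : Prop :=
  ∃ f : M.carrier ≃ N.carrier,
    (∀ (h : G) (m : M.carrier), f (h • m) = h • f m) ∧
    (∀ (g : Gᵐᵒᵖ) (m : M.carrier), f (g • m) = g • f m)

theorem Iso.refl (M : Biset G) : Iso M M := ⟨Equiv.refl _, fun _ _ => rfl, fun _ _ => rfl⟩

theorem Iso.symm {M N : Biset G} : Iso M N → Iso N M := by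
  rintro ⟨f, hl, hr⟩
  refine ⟨f.symm, fun h n => ?_, fun g n => ?_⟩
  · rw [Equiv.symm_apply_eq, hl, Equiv.apply_symm_apply]
  · rw [Equiv.symm_apply_eq, hr, Equiv.apply_symm_apply]

theorem Iso.trans {M N L : Biset G} : Iso M N → Iso N L → Iso M L := by
  rintro ⟨f, hl, hr⟩ ⟨f', hl', hr'⟩
  exact ⟨f.trans f', fun h m => by simp [hl, hl'], fun g m => by simp [hr, hr']⟩

instance setoid (G : Type) [Group G] : Setoid (Biset G) where
  r := Iso
  iseqv := ⟨Iso.refl, Iso.symm, Iso.trans⟩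

/-- The disjoint union of two bisets. -/
def sum (M N : Biset G) : Biset G where
  carrier := M.carrier ⊕ N.carrier

/-- The group `G` itself, acted upon by left and right multiplication. -/
def self (G : Type) [Group G] [Finite G] : Biset G where
  carrier := G

/-- The orbits of `G` on `M × N`, where `g` maps `(m, n)` to `(m g⁻¹, g n)`. -/
instance tensorSetoid (M N : Biset G) : Setoid (M.carrier × N.carrier) where
  r p q := ∃ g : G, q = (MulOpposite.op g⁻¹ • p.1, g • p.2)
  iseqv :=
    { refl := fun p => ⟨1, by simp⟩
      symm := by
        rintro p q ⟨g, rfl⟩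
        exact ⟨g⁻¹, by simp [smul_smul]⟩
      trans := by
        rintro p q r ⟨g, rfl⟩ ⟨k, rfl⟩
        exact ⟨k * g, by simp [smul_smul]⟩ }

/-- The tensor product `M ×_G N`: the set of `G`-orbits on `M × N`, with
`h (m ×_G n) p = (h m) ×_G (n p)`. -/
def tensor (M N : Biset G) : Biset G where
  carrier := Quotient (tensorSetoid M N)
  finite := Quotient.finite _
  left :=
    { smul := fun h => Quotient.map (fun p => (h • p.1, p.2)) (by
        rintro p q ⟨g, rfl⟩
        exact ⟨g, by simp [smul_comm]⟩)
      one_smul := by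
        rintro ⟨m, n⟩
        exact congrArg (Quotient.mk _) (Prod.ext (one_smul _ m) rfl)
      mul_smul := by
        rintro h k ⟨m, n⟩
        exact congrArg (Quotient.mk _) (Prod.ext (mul_smul h k m) rfl) }
  right :=
    { smul := fun x => Quotient.map (fun p => (p.1, x • p.2)) (by
        rintro p q ⟨g, rfl⟩
        exact ⟨g, by simp [smul_comm]⟩)
      one_smul := by
        rintro ⟨m, n⟩
        exact congrArg (Quotient.mk _) (Prod.ext rfl (one_smul _ n))
      mul_smul := by
        rintro h k ⟨m, n⟩
        exact congrArg (Quotient.mk _) (Prod.ext rfl (mul_smul h k n)) }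
  comm := by
    refine @SMulCommClass.mk _ _ _ (_) (_) ?_
    rintro h g ⟨m, n⟩
    rfl

/-- The element `m ×_G n` of `M ×_G N`. -/
def tmk {M N : Biset G} (m : M.carrier) (n : N.carrier) : (tensor M N).carrier :=
  Quotient.mk (tensorSetoid M N) (m, n)

theorem smul_tmk {M N : Biset G} (h : G) (m : M.carrier) (n : N.carrier) :
    h • tmk m n = tmk (h • m) n := rfl

theorem op_smul_tmk {M N : Biset G} (g : Gᵐᵒᵖ) (m : M.carrier) (n : N.carrier) :
    g • tmk m n = tmk m (g • n) := rfl

theorem tmk_eq {M N : Biset G} (g : G) (m : M.carrier) (n : N.carrier) :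
    tmk (MulOpposite.op g • m) n = tmk m (g • n) :=
  Quotient.sound ⟨g, by simp [smul_smul]⟩

theorem tensor_ind {M N : Biset G} {P : (tensor M N).carrier → Prop}
    (h : ∀ m n, P (tmk m n)) (x : (tensor M N).carrier) : P x := by
  obtain ⟨m, n⟩ := x
  exact h m n

/-- Maps out of `M ×_G N` are balanced maps out of `M × N`. -/
def tlift {M N : Biset G} {X : Type} (f : M.carrier → N.carrier → X)
    (hf : ∀ (g : G) m n, f (MulOpposite.op g • m) n = f m (g • n)) :
    (tensor M N).carrier → X :=
  Quotient.lift (fun p => f p.1 p.2) (by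
    rintro p q ⟨g, rfl⟩
    simp [← hf, smul_smul])

theorem tlift_tmk {M N : Biset G} {X : Type} (f : M.carrier → N.carrier → X)
    (hf : ∀ (g : G) m n, f (MulOpposite.op g • m) n = f m (g • n)) (m : M.carrier)
    (n : N.carrier) : tlift f hf (tmk m n) = f m n := rfl

theorem tensor_congr {M M' N N' : Biset G} :
    Iso M M' → Iso N N' → Iso (tensor M N) (tensor M' N') := by
  rintro ⟨f, fl, fr⟩ ⟨k, kl, kr⟩
  have fl' := (Iso.symm ⟨f, fl, fr⟩ : Iso M' M)
  have hfs : ∀ (g : Gᵐᵒᵖ) m, f.symm (g • m) = g • f.symm m := fun g m => by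
    rw [Equiv.symm_apply_eq, fr, Equiv.apply_symm_apply]
  have hks : ∀ (g : G) m, k.symm (g • m) = g • k.symm m := fun g m => by
    rw [Equiv.symm_apply_eq, kl, Equiv.apply_symm_apply]
  refine ⟨⟨tlift (fun m n => tmk (f m) (k n)) ?_,
    tlift (fun m n => tmk (f.symm m) (k.symm n)) ?_, ?_, ?_⟩, ?_, ?_⟩
  · intro g m n
    rw [fr, kl, tmk_eq]
  · intro g m n
    rw [hfs, hks, tmk_eq]
  · exact tensor_ind fun m n => by simp [tlift_tmk]
  · exact tensor_ind fun m n => by simp [tlift_tmk]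
  · exact fun h => tensor_ind fun m n => by simp [tlift_tmk, smul_tmk, fl]
  · exact fun h => tensor_ind fun m n => by simp [tlift_tmk, op_smul_tmk, kr]

theorem tensor_assoc (M N L : Biset G) :
    Iso (tensor (tensor M N) L) (tensor M (tensor N L)) := by
  refine ⟨⟨tlift (fun x l => tlift (M := M) (N := N) (fun m n => tmk m (tmk n l)) ?_ x) ?_,
    tlift (fun m x => tlift (M := N) (N := L) (fun n l => tmk (tmk m n) l) ?_ x) ?_,
    ?_, ?_⟩, ?_, ?_⟩
  · intro g m n
    rw [tmk_eq, smul_tmk]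
  · intro g x l
    induction x using tensor_ind with
    | h m n => simp [op_smul_tmk, tlift_tmk, tmk_eq]
  · intro g n l
    rw [← op_smul_tmk, tmk_eq]
  · intro g m x
    induction x using tensor_ind with
    | h n l => simp [smul_tmk, tlift_tmk, tmk_eq]
  · refine tensor_ind fun x l => ?_
    induction x using tensor_ind with
    | h m n => rfl
  · refine tensor_ind fun m x => ?_
    induction x using tensor_ind with
    | h n l => rfl
  · refine fun h => tensor_ind fun x l => ?_
    induction x using tensor_ind with
    | h m n => rfl
  · refine fun h => tensor_ind fun x l => ?_
    induction x using tensor_ind with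
    | h m n => rfl

theorem self_tensor [Finite G] (M : Biset G) : Iso (tensor (self G) M) M := by
  refine ⟨⟨tlift (fun (g : G) m => g • m) ?_, fun m => tmk (M := self G) (1 : G) m,
    ?_, ?_⟩, ?_, ?_⟩
  · intro g (h : G) m
    exact mul_smul h g m
  · refine tensor_ind fun (g : G) m => ?_
    refine (tmk_eq (M := self G) g (1 : G) m).symm.trans ?_
    exact congrArg (fun x => tmk (M := self G) x m) (one_mul g)
  · exact fun m => one_smul G m
  · exact fun h => tensor_ind fun (g : G) m => mul_smul h g m
  · exact fun h => tensor_ind fun (g : G) m => smul_comm g h m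

theorem tensor_self [Finite G] (M : Biset G) : Iso (tensor M (self G)) M := by
  refine ⟨⟨tlift (fun m (g : G) => MulOpposite.op g • m) ?_,
    fun m => tmk (N := self G) m (1 : G), ?_, ?_⟩, ?_, ?_⟩
  · intro g m (h : G)
    exact (mul_smul (MulOpposite.op h) (MulOpposite.op g) m).symm
  · refine tensor_ind fun m (g : G) => ?_
    refine (tmk_eq (N := self G) g m (1 : G)).trans ?_
    exact congrArg (fun x => tmk (N := self G) m x) (mul_one g)
  · exact fun m => one_smul Gᵐᵒᵖ m
  · exact fun h => tensor_ind fun m (g : G) => (smul_comm h (MulOpposite.op g) m).symm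
  · exact fun h => tensor_ind fun m (g : G) => mul_smul h (MulOpposite.op g) m

/-- The tensor product distributes over disjoint unions on the left. -/
theorem sum_tensor (M N L : Biset G) :
    Iso (tensor (sum M N) L) (sum (tensor M L) (tensor N L)) := by
  refine ⟨⟨tlift (fun x l => Sum.map (fun m => tmk m l) (fun n => tmk n l) x) ?_,
    Sum.elim (tlift (fun m l => tmk (M := sum M N) (Sum.inl m) l) ?_)
      (tlift (fun n l => tmk (M := sum M N) (Sum.inr n) l) ?_), ?_, ?_⟩, ?_, ?_⟩
  · rintro g (m | n) l
    · exact congrArg Sum.inl (tmk_eq g m l)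
    · exact congrArg Sum.inr (tmk_eq g n l)
  · exact fun g m l => tmk_eq (M := sum M N) g (Sum.inl m) l
  · exact fun g m l => tmk_eq (M := sum M N) g (Sum.inr m) l
  · refine tensor_ind fun x l => ?_
    rcases x with m | n <;> rfl
  · rintro (⟨m, l⟩ | ⟨n, l⟩) <;> rfl
  · refine fun h => tensor_ind fun x l => ?_
    rcases x with m | n <;> rfl
  · refine fun h => tensor_ind fun x l => ?_
    rcases x with m | n <;> rfl

/-- The tensor product distributes over disjoint unions on the right. -/
theorem tensor_sum (L M N : Biset G) :
    Iso (tensor L (sum M N)) (sum (tensor L M) (tensor L N)) := by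
  refine ⟨⟨tlift (fun l x => Sum.map (fun m => tmk l m) (fun n => tmk l n) x) ?_,
    Sum.elim (tlift (fun l m => tmk (N := sum M N) l (Sum.inl m)) ?_)
      (tlift (fun l n => tmk (N := sum M N) l (Sum.inr n)) ?_), ?_, ?_⟩, ?_, ?_⟩
  · rintro g l (m | n)
    · exact congrArg Sum.inl (tmk_eq g l m)
    · exact congrArg Sum.inr (tmk_eq g l n)
  · exact fun g l m => tmk_eq (N := sum M N) g l (Sum.inl m)
  · exact fun g l m => tmk_eq (N := sum M N) g l (Sum.inr m)
  · refine tensor_ind fun l x => ?_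
    rcases x with m | n <;> rfl
  · rintro (⟨l, m⟩ | ⟨l, n⟩) <;> rfl
  · refine fun h => tensor_ind fun l x => ?_
    rcases x with m | n <;> rfl
  · refine fun h => tensor_ind fun l x => ?_
    rcases x with m | n <;> rfl

/-- The transitive biset `(G × G) / U`, with `h · y · g = (h, g⁻¹) y`. -/
def coset [Finite G] (U : Subgroup (G × G)) : Biset G where
  carrier := (G × G) ⧸ U
  left := MulAction.compHom _ (MonoidHom.inl G G)
  right :=
    { smul := fun g y => ((1 : G), g.unop⁻¹) • y
      one_smul := fun y => by
        change ((1 : G), (1 : Gᵐᵒᵖ).unop⁻¹) • y = y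
        rw [MulOpposite.unop_one, inv_one]
        exact one_smul (G × G) y
      mul_smul := fun g h y => by
        change ((1 : G), (g * h).unop⁻¹) • y =
          ((1 : G), g.unop⁻¹) • ((1 : G), h.unop⁻¹) • y
        rw [smul_smul, MulOpposite.unop_mul, mul_inv_rev, Prod.mk_mul_mk, one_mul] }
  comm := by
    refine @SMulCommClass.mk _ _ _ (_) (_) fun h g y => ?_
    change (h, (1 : G)) • ((1 : G), g.unop⁻¹) • y = ((1 : G), g.unop⁻¹) • (h, (1 : G)) • y
    simp [smul_smul]

end Biset

/-! ### The double Burnside algebra -/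

/-- The isomorphism classes of finite `(G, G)`-bisets. -/
def BisetClass (G : Type) [Group G] : Type 1 := Quotient (Biset.setoid G)

/-- The isomorphism class of a biset. -/
def BisetClass.mk {G : Type} [Group G] (M : Biset G) : BisetClass G :=
  Quotient.mk (Biset.setoid G) M

/-- The isomorphism classes form a monoid under the tensor product, with the class of `G` as
neutral element. -/
instance BisetClass.instMonoid (G : Type) [Group G] [Finite G] : Monoid (BisetClass G) where
  one := BisetClass.mk (Biset.self G)
  mul := Quotient.map₂ Biset.tensor fun _ _ h _ _ k => Biset.tensor_congr h k
  mul_assoc := by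
    rintro ⟨M⟩ ⟨N⟩ ⟨L⟩
    exact Quotient.sound (Biset.tensor_assoc M N L)
  one_mul := by
    rintro ⟨M⟩
    exact Quotient.sound (Biset.self_tensor M)
  mul_one := by
    rintro ⟨M⟩
    exact Quotient.sound (Biset.tensor_self M)

/-- The relations `[M ⊔ N] = [M] + [N]` on the free `R`-module on the isomorphism classes. -/
inductive BurnsideRel (R : Type) [CommRing R] (G : Type) [Group G] [Finite G] :
    MonoidAlgebra R (BisetClass G) → MonoidAlgebra R (BisetClass G) → Prop
  | sum (M N : Biset G) : BurnsideRel R G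
      (MonoidAlgebra.of R _ (BisetClass.mk (M.sum N)))
      (MonoidAlgebra.of R _ (BisetClass.mk M) + MonoidAlgebra.of R _ (BisetClass.mk N))

/-- The double Burnside `R`-algebra `B_R(G, G)`: the free `R`-module on the isomorphism classes
of finite `(G, G)`-bisets, with the bilinear multiplication extending `[M] [N] = [M ×_G N]`,
modulo the relations `[M ⊔ N] = [M] + [N]`. (As the tensor product distributes over disjoint
unions, see `Biset.sum_tensor` and `Biset.tensor_sum`, the `R`-submodule generated by
these relations is already a two-sided ideal.) -/
abbrev DoubleBurnside (R : Type) [CommRing R] (G : Type) [Group G] [Finite G] : Type 1 :=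
  RingQuot (BurnsideRel R G)

namespace DoubleBurnside

/-- The class `[M]` in `B_R(G, G)` of a finite biset `M`. -/
def cls (R : Type) [CommRing R] {G : Type} [Group G] [Finite G] (M : Biset G) :
    DoubleBurnside R G :=
  RingQuot.mkAlgHom R (BurnsideRel R G) (MonoidAlgebra.of R _ (BisetClass.mk M))

/-- The ring morphism `B_R(G, G) → B_S(G, G)` induced by a morphism `R → S` on coefficients; it
maps `[M]` to `[M]`. -/
def mapCoeff {R S : Type} [CommRing R] [CommRing S] (f : R →+* S) (G : Type) [Group G]
    [Finite G] : DoubleBurnside R G →+* DoubleBurnside S G :=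
  RingQuot.lift ⟨(RingQuot.mkRingHom (BurnsideRel S G)).comp
      (MonoidAlgebra.mapRingHom (BisetClass G) f), by
    rintro _ _ ⟨M, N⟩
    have h := RingQuot.mkRingHom_rel (BurnsideRel.sum (R := S) M N)
    simpa [MonoidAlgebra.of_apply] using h⟩

theorem mapCoeff_cls {R S : Type} [CommRing R] [CommRing S] (f : R →+* S) {G : Type} [Group G]
    [Finite G] (M : Biset G) : mapCoeff f G (cls R M) = cls S M := by
  have hR : RingQuot.mkAlgHom R (BurnsideRel R G) (MonoidAlgebra.of R _ (BisetClass.mk M)) =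
      RingQuot.mkRingHom (BurnsideRel R G) (MonoidAlgebra.of R _ (BisetClass.mk M)) :=
    DFunLike.congr_fun (RingQuot.mkAlgHom_coe R (BurnsideRel R G)) _
  have hS : RingQuot.mkAlgHom S (BurnsideRel S G) (MonoidAlgebra.of S _ (BisetClass.mk M)) =
      RingQuot.mkRingHom (BurnsideRel S G) (MonoidAlgebra.of S _ (BisetClass.mk M)) :=
    DFunLike.congr_fun (RingQuot.mkAlgHom_coe S (BurnsideRel S G)) _
  rw [cls, cls, hR, hS, mapCoeff, RingQuot.lift_mkRingHom_apply]
  simp [MonoidAlgebra.of_apply]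

end DoubleBurnside

/-! ### The `ℚ`-algebra `A` -/

/-- `K[η, ξ] / (η², η ξ, ξ²)`: the square-zero extension of `K` by the free module on
`η = inr (1, 0)` and `ξ = inr (0, 1)`. The element `z₁ + z₂ η + z₃ ξ` is `(z₁, (z₂, z₃))`. -/
abbrev EtaXi (K : Type) : Type := TrivSqZeroExt K (K × K)

namespace EtaXi

def η : EtaXi ℚ := TrivSqZeroExt.inr (1, 0)

def ξ : EtaXi ℚ := TrivSqZeroExt.inr (0, 1)

theorem relations : η * η = 0 ∧ η * ξ = 0 ∧ ξ * ξ = 0 := by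
  simp [η, ξ]

end EtaXi

/-- The `ℚ`-vector space
`[ℚ^{3×3}, 0, 0, ℚ^{3×1}; 0, ℚ, 0, ℚ; 0, 0, ℚ, 0; ℚ^{1×3}, ℚ, 0, ℚ[η, ξ]]`,
with the entries `s` in position `(1,1)`, `t` in `(1,4)`, `u` in `(2,2)`, `v` in `(2,4)`,
`w` in `(3,3)`, `x` in `(4,1)`, `y` in `(4,2)` and `z` in `(4,4)`. -/
@[ext]
structure PeirceAlg where
  s : Matrix (Fin 3) (Fin 3) ℚ
  t : Fin 3 → ℚ
  u : ℚ
  v : ℚ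
  w : ℚ
  x : Fin 3 → ℚ
  y : ℚ
  z : EtaXi ℚ

namespace PeirceAlg

open Matrix EtaXi

instance : Zero PeirceAlg := ⟨⟨0, 0, 0, 0, 0, 0, 0, 0⟩⟩
instance : One PeirceAlg := ⟨⟨1, 0, 1, 0, 1, 0, 0, 1⟩⟩
instance : Add PeirceAlg := ⟨fun a b =>
  ⟨a.s + b.s, a.t + b.t, a.u + b.u, a.v + b.v, a.w + b.w, a.x + b.x, a.y + b.y, a.z + b.z⟩⟩
instance : Neg PeirceAlg := ⟨fun a => ⟨-a.s, -a.t, -a.u, -a.v, -a.w, -a.x, -a.y, -a.z⟩⟩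
instance : SMul ℚ PeirceAlg := ⟨fun c a =>
  ⟨c • a.s, c • a.t, c • a.u, c • a.v, c • a.w, c • a.x, c • a.y, c • a.z⟩⟩

/-- The multiplication of `A`: block matrix multiplication, where the products of the blocks
in positions `(1,4)·(4,1)` and `(2,4)·(4,2)` are zero, `η` and `ξ` act as zero on the blocks in
positions `(1,4)`, `(2,4)`, `(4,1)`, `(4,2)`, the product `(4,1)·(1,4)` is
`(x, t) ↦ (x t) η` and the product `(4,2)·(2,4)` is `(y, v) ↦ y v (ξ - 12 η)`. -/
instance : Mul PeirceAlg := ⟨fun a b =>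
  { s := a.s * b.s
    t := a.s *ᵥ b.t + b.z.fst • a.t
    u := a.u * b.u
    v := a.u * b.v + a.v * b.z.fst
    w := a.w * b.w
    x := a.x ᵥ* b.s + a.z.fst • b.x
    y := a.y * b.u + a.z.fst * b.y
    z := (a.x ⬝ᵥ b.t) • η + (a.y * b.v) • (ξ - (12 : ℚ) • η) + a.z * b.z }⟩

section lemmas
variable (a b : PeirceAlg) (c : ℚ)
@[simp] theorem zero_s : (0 : PeirceAlg).s = 0 := rfl
@[simp] theorem zero_t : (0 : PeirceAlg).t = 0 := rfl
@[simp] theorem zero_u : (0 : PeirceAlg).u = 0 := rfl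
@[simp] theorem zero_v : (0 : PeirceAlg).v = 0 := rfl
@[simp] theorem zero_w : (0 : PeirceAlg).w = 0 := rfl
@[simp] theorem zero_x : (0 : PeirceAlg).x = 0 := rfl
@[simp] theorem zero_y : (0 : PeirceAlg).y = 0 := rfl
@[simp] theorem zero_z : (0 : PeirceAlg).z = 0 := rfl
@[simp] theorem one_s : (1 : PeirceAlg).s = 1 := rfl
@[simp] theorem one_t : (1 : PeirceAlg).t = 0 := rfl
@[simp] theorem one_u : (1 : PeirceAlg).u = 1 := rfl
@[simp] theorem one_v : (1 : PeirceAlg).v = 0 := rfl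
@[simp] theorem one_w : (1 : PeirceAlg).w = 1 := rfl
@[simp] theorem one_x : (1 : PeirceAlg).x = 0 := rfl
@[simp] theorem one_y : (1 : PeirceAlg).y = 0 := rfl
@[simp] theorem one_z : (1 : PeirceAlg).z = 1 := rfl
@[simp] theorem add_s : (a + b).s = a.s + b.s := rfl
@[simp] theorem add_t : (a + b).t = a.t + b.t := rfl
@[simp] theorem add_u : (a + b).u = a.u + b.u := rfl
@[simp] theorem add_v : (a + b).v = a.v + b.v := rfl
@[simp] theorem add_w : (a + b).w = a.w + b.w := rfl
@[simp] theorem add_x : (a + b).x = a.x + b.x := rfl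
@[simp] theorem add_y : (a + b).y = a.y + b.y := rfl
@[simp] theorem add_z : (a + b).z = a.z + b.z := rfl
@[simp] theorem neg_s : (-a).s = -a.s := rfl
@[simp] theorem neg_t : (-a).t = -a.t := rfl
@[simp] theorem neg_u : (-a).u = -a.u := rfl
@[simp] theorem neg_v : (-a).v = -a.v := rfl
@[simp] theorem neg_w : (-a).w = -a.w := rfl
@[simp] theorem neg_x : (-a).x = -a.x := rfl
@[simp] theorem neg_y : (-a).y = -a.y := rfl
@[simp] theorem neg_z : (-a).z = -a.z := rfl
@[simp] theorem smul_s : (c • a).s = c • a.s := rfl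
@[simp] theorem smul_t : (c • a).t = c • a.t := rfl
@[simp] theorem smul_u : (c • a).u = c • a.u := rfl
@[simp] theorem smul_v : (c • a).v = c • a.v := rfl
@[simp] theorem smul_w : (c • a).w = c • a.w := rfl
@[simp] theorem smul_x : (c • a).x = c • a.x := rfl
@[simp] theorem smul_y : (c • a).y = c • a.y := rfl
@[simp] theorem smul_z : (c • a).z = c • a.z := rfl
@[simp] theorem mul_s : (a * b).s = a.s * b.s := rfl
@[simp] theorem mul_t : (a * b).t = a.s *ᵥ b.t + b.z.fst • a.t := rfl
@[simp] theorem mul_u : (a * b).u = a.u * b.u := rfl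
@[simp] theorem mul_v : (a * b).v = a.u * b.v + a.v * b.z.fst := rfl
@[simp] theorem mul_w : (a * b).w = a.w * b.w := rfl
@[simp] theorem mul_x : (a * b).x = a.x ᵥ* b.s + a.z.fst • b.x := rfl
@[simp] theorem mul_y : (a * b).y = a.y * b.u + a.z.fst * b.y := rfl
@[simp] theorem mul_z : (a * b).z =
    (a.x ⬝ᵥ b.t) • η + (a.y * b.v) • (ξ - (12 : ℚ) • η) + a.z * b.z := rfl
end lemmas

theorem fst_mul_z (a b : PeirceAlg) : (a * b).z.fst = a.z.fst * b.z.fst := by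
  simp [η, ξ]

instance : AddCommGroup PeirceAlg where
  add_assoc a b c := by ext1 <;> simp [add_assoc]
  zero_add a := by ext1 <;> simp
  add_zero a := by ext1 <;> simp
  add_comm a b := by ext1 <;> simp [add_comm]
  neg_add_cancel a := by ext1 <;> simp
  nsmul := nsmulRec
  zsmul := zsmulRec

instance : Module ℚ PeirceAlg where
  one_smul a := by ext1 <;> simp
  mul_smul c d a := by ext1 <;> simp [mul_smul, mul_assoc]
  smul_zero c := by ext1 <;> simp
  smul_add c a b := by ext1 <;> simp [mul_add]
  add_smul c d a := by ext1 <;> simp [add_smul, add_mul]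
  zero_smul a := by ext1 <;> simp

theorem mul_assoc' (a b c : PeirceAlg) : a * b * c = a * (b * c) := by
  refine PeirceAlg.ext ?_ ?_ ?_ ?_ ?_ ?_ ?_ ?_
  · simp [mul_assoc]
  · rw [mul_t, mul_t, mul_t, mul_t, fst_mul_z]
    rw [mul_s, ← mulVec_mulVec, mulVec_add, mulVec_smul, smul_add, smul_smul, add_assoc,
      mul_comm c.z.fst]
  · simp [mul_assoc]
  · rw [mul_v, mul_v, mul_v, mul_v, fst_mul_z]
    simp; ring
  · simp [mul_assoc]
  · rw [mul_x, mul_x, fst_mul_z]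
    simp [add_vecMul, smul_vecMul, add_assoc, smul_smul]
  · rw [mul_y, mul_y, fst_mul_z]
    simp; ring
  · ext <;> simp [η, ξ, dotProduct_mulVec] <;> ring

instance : Ring PeirceAlg where
  __ := (inferInstance : AddCommGroup PeirceAlg)
  mul_assoc := mul_assoc'
  one_mul a := by ext1 <;> simp
  mul_one a := by ext1 <;> simp
  zero_mul a := by ext1 <;> simp
  mul_zero a := by ext1 <;> simp
  left_distrib a b c := by
    refine PeirceAlg.ext ?_ ?_ ?_ ?_ ?_ ?_ ?_ ?_
    · simp [mul_add]
    · simp [mulVec_add, add_smul]; abel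
    · simp [mul_add]
    · simp; ring
    · simp [mul_add]
    · simp [vecMul_add]; abel
    · simp; ring
    · simp [mul_add, add_smul]; abel
  right_distrib a b c := by
    refine PeirceAlg.ext ?_ ?_ ?_ ?_ ?_ ?_ ?_ ?_
    · simp [add_mul]
    · simp [add_mulVec]; abel
    · simp [add_mul]
    · simp; ring
    · simp [add_mul]
    · simp [add_vecMul, add_smul]; abel
    · simp; ring
    · simp [add_mul, add_smul]; abel

instance : Algebra ℚ PeirceAlg := Algebra.ofModule
  (fun c a b => by
    refine PeirceAlg.ext ?_ ?_ ?_ ?_ ?_ ?_ ?_ ?_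
    · simp
    · simp [smul_mulVec, smul_comm c]
    · simp [mul_assoc]
    · simp; ring
    · simp [mul_assoc]
    · simp [smul_vecMul, smul_smul]
    · simp; ring
    · simp [smul_smul, mul_assoc])
  (fun c a b => by
    refine PeirceAlg.ext ?_ ?_ ?_ ?_ ?_ ?_ ?_ ?_
    · simp
    · simp [mulVec_smul, smul_smul]
    · simp; ring
    · simp; ring
    · simp; ring
    · simp [vecMul_smul, smul_comm c]
    · simp; ring
    · simp [smul_smul, mul_left_comm])

/-- The first conjugating unit. -/
def x₁ : PeirceAlgˣ where
  val := { (1 : PeirceAlg) with s := !![0, -2, 0; 6, 6, -4; 0, 0, 1] }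
  inv := { (1 : PeirceAlg) with s := !![1/2, 1/6, 2/3; -1/2, 0, 0; 0, 0, 1] }
  val_inv := by
    refine PeirceAlg.ext ?_ ?_ ?_ ?_ ?_ ?_ ?_ ?_ <;>
      simp [← Matrix.ext_iff, Fin.forall_fin_succ]
    norm_num
  inv_val := by
    refine PeirceAlg.ext ?_ ?_ ?_ ?_ ?_ ?_ ?_ ?_ <;>
      simp [← Matrix.ext_iff, Fin.forall_fin_succ]
    norm_num

/-- The second conjugating unit. -/
def x₂ : PeirceAlgˣ where
  val := { (1 : PeirceAlg) with s := !![1, 0, 0; 0, 1, 0; 0, 7, 1] }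
  inv := { (1 : PeirceAlg) with s := !![1, 0, 0; 0, 1, 0; 0, -7, 1] }
  val_inv := by
    refine PeirceAlg.ext ?_ ?_ ?_ ?_ ?_ ?_ ?_ ?_ <;>
      simp [← Matrix.ext_iff, Fin.forall_fin_succ]
  inv_val := by
    refine PeirceAlg.ext ?_ ?_ ?_ ?_ ?_ ?_ ?_ ?_ <;>
      simp [← Matrix.ext_iff, Fin.forall_fin_succ]

/-- The third conjugating unit. -/
def x₃ : PeirceAlgˣ where
  val := { (1 : PeirceAlg) with t := ![0, 0, 1], x := ![0, 0, 6] }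
  inv := { (1 : PeirceAlg) with t := ![0, 0, -1], x := ![0, 0, -6], z := 1 + (6 : ℚ) • η }
  val_inv := by
    refine PeirceAlg.ext ?_ ?_ ?_ ?_ ?_ ?_ ?_ ?_ <;> simp [η, ξ]
  inv_val := by
    refine PeirceAlg.ext ?_ ?_ ?_ ?_ ?_ ?_ ?_ ?_ <;> simp [η, ξ]

end PeirceAlg

/-! ### The elements of `B_ℚ(S₃, S₃)` -/

/-- The symmetric group on three letters, which are numbered `0`, `1`, `2`. -/
abbrev S₃ : Type := Equiv.Perm (Fin 3)

namespace S₃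

/-- The transposition of the first two letters. -/
def a : S₃ := Equiv.swap 0 1

/-- The three-cycle `0 ↦ 1 ↦ 2 ↦ 0`. -/
def b : S₃ := finRotate 3

def V₀ : Subgroup S₃ := ⊥
def V₁ : Subgroup S₃ := Subgroup.zpowers a
def V₄ : Subgroup S₃ := Subgroup.zpowers b
def V₅ : Subgroup S₃ := ⊤

/-- The class of `(S₃ × S₃) / (P × Q)`. -/
def H (P Q : Subgroup S₃) : DoubleBurnside ℚ S₃ :=
  DoubleBurnside.cls ℚ (Biset.coset (P.prod Q))

/-- The class of `(S₃ × S₃) / Δ(V)` with `Δ(V) = {(v, v) : v ∈ V}`. -/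
def HΔ (V : Subgroup S₃) : DoubleBurnside ℚ S₃ :=
  DoubleBurnside.cls ℚ (Biset.coset (V.map ((MonoidHom.id S₃).prod (MonoidHom.id S₃))))

def H₆ : DoubleBurnside ℚ S₃ :=
  DoubleBurnside.cls ℚ (Biset.coset (Subgroup.closure {(a, a), (1, b)}))

def H₇ : DoubleBurnside ℚ S₃ :=
  DoubleBurnside.cls ℚ (Biset.coset (Subgroup.closure {(a, a), (b, 1)}))

def H₈ : DoubleBurnside ℚ S₃ :=
  DoubleBurnside.cls ℚ (Biset.coset (Subgroup.closure {(a, a), (b, 1), (1, b)}))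

/-! The idempotents `e`, `g`, `h`, `ε₂`, `ε₃`, `ε₄`, and the basis elements of the Peirce
components; `b_i_j` lies in the component of `i` and `j`. -/

def elt_e : DoubleBurnside ℚ S₃ :=
  (-1/2 : ℚ) • (H V₀ V₀) + (H V₁ V₀) + (1/2 : ℚ) • (H V₄ V₀)

def b_e_g : DoubleBurnside ℚ S₃ :=
  (1/2 : ℚ) • (H V₀ V₀) - (H V₁ V₀) - (1/2 : ℚ) • (H V₀ V₁) - (1/2 : ℚ) • (H V₄ V₀) + (H V₁ V₁)
    + (1/2 : ℚ) • (H V₄ V₁)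

def b_e_h : DoubleBurnside ℚ S₃ :=
  (-1/8 : ℚ) • (H V₀ V₀) + (1/4 : ℚ) • (H V₁ V₀) + (1/2 : ℚ) • (H V₀ V₁) + (1/8 : ℚ) • (H V₄ V₀)
    - (3/8 : ℚ) • (H V₀ V₄) - (H V₁ V₁) - (1/2 : ℚ) • (H V₄ V₁) + (3/4 : ℚ) • (H V₁ V₄)
    + (3/8 : ℚ) • (H V₄ V₄)

def b_g_e : DoubleBurnside ℚ S₃ :=
  (-4/3 : ℚ) • (H V₀ V₀) + (2 : ℚ) • (H V₁ V₀) + (H V₄ V₀)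

def elt_g : DoubleBurnside ℚ S₃ :=
  (4/3 : ℚ) • (H V₀ V₀) - (2 : ℚ) • (H V₁ V₀) - (4/3 : ℚ) • (H V₀ V₁) - (H V₄ V₀)
    + (2 : ℚ) • (H V₁ V₁) + (H V₄ V₁)

def b_g_h : DoubleBurnside ℚ S₃ :=
  (-1/3 : ℚ) • (H V₀ V₀) + (1/2 : ℚ) • (H V₁ V₀) + (4/3 : ℚ) • (H V₀ V₁) + (1/4 : ℚ) • (H V₄ V₀)
    - (H V₀ V₄) - (2 : ℚ) • (H V₁ V₁) - (H V₄ V₁) + (3/2 : ℚ) • (H V₁ V₄) + (3/4 : ℚ) • (H V₄ V₄)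

def b_h_e : DoubleBurnside ℚ S₃ :=
  (-1/3 : ℚ) • (H V₀ V₀) + (H V₄ V₀)

def b_h_g : DoubleBurnside ℚ S₃ :=
  (1/3 : ℚ) • (H V₀ V₀) - (1/3 : ℚ) • (H V₀ V₁) - (H V₄ V₀) + (H V₄ V₁)

def elt_h : DoubleBurnside ℚ S₃ :=
  (-1/12 : ℚ) • (H V₀ V₀) + (1/3 : ℚ) • (H V₀ V₁) + (1/4 : ℚ) • (H V₄ V₀) - (1/4 : ℚ) • (H V₀ V₄)
    - (H V₄ V₁) + (3/4 : ℚ) • (H V₄ V₄)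

def b_e_ε₄ : DoubleBurnside ℚ S₃ :=
  (-1/8 : ℚ) • (H V₀ V₀) + (1/4 : ℚ) • (H V₁ V₀) + (1/4 : ℚ) • (H V₀ V₁) + (1/8 : ℚ) • (H V₄ V₀)
    + (1/8 : ℚ) • (H V₀ V₄) - (1/2 : ℚ) • (H V₁ V₁) - (1/4 : ℚ) • (H V₀ V₅)
    - (1/4 : ℚ) • (H V₄ V₁) - (1/4 : ℚ) • (H V₁ V₄) - (1/8 : ℚ) • (H V₄ V₄)
    + (1/2 : ℚ) • (H V₁ V₅) + (1/4 : ℚ) • (H V₄ V₅)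

def b_g_ε₄ : DoubleBurnside ℚ S₃ :=
  (-1/3 : ℚ) • (H V₀ V₀) + (1/2 : ℚ) • (H V₁ V₀) + (2/3 : ℚ) • (H V₀ V₁) + (1/4 : ℚ) • (H V₄ V₀)
    + (1/3 : ℚ) • (H V₀ V₄) - (H V₁ V₁) - (2/3 : ℚ) • (H V₀ V₅) - (1/2 : ℚ) • (H V₄ V₁)
    - (1/2 : ℚ) • (H V₁ V₄) - (1/4 : ℚ) • (H V₄ V₄) + (H V₁ V₅) + (1/2 : ℚ) • (H V₄ V₅)

def b_h_ε₄ : DoubleBurnside ℚ S₃ :=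
  (-1/12 : ℚ) • (H V₀ V₀) + (1/6 : ℚ) • (H V₀ V₁) + (1/4 : ℚ) • (H V₄ V₀) + (1/12 : ℚ) • (H V₀ V₄)
    - (1/6 : ℚ) • (H V₀ V₅) - (1/2 : ℚ) • (H V₄ V₁) - (1/4 : ℚ) • (H V₄ V₄)
    + (1/2 : ℚ) • (H V₄ V₅)

def ε₂ : DoubleBurnside ℚ S₃ :=
  -(H V₀ V₀) + (H V₁ V₀) + (H V₀ V₁) + (HΔ V₁) - (2 : ℚ) • (H V₁ V₁)

def b_ε₂_ε₄ : DoubleBurnside ℚ S₃ :=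
  (-1/2 : ℚ) • (H V₀ V₀) + (1/2 : ℚ) • (H V₁ V₀) + (1/2 : ℚ) • (H V₀ V₁) + (1/2 : ℚ) • (HΔ V₁)
    + (1/2 : ℚ) • (H V₀ V₄) - (H V₁ V₁) - (1/2 : ℚ) • (H V₀ V₅) - (1/2 : ℚ) • H₆
    - (1/2 : ℚ) • (H V₁ V₄) + (H V₁ V₅)

def ε₃ : DoubleBurnside ℚ S₃ :=
  (-1/4 : ℚ) • (H V₀ V₀) + (1/4 : ℚ) • (H V₄ V₀) + (1/4 : ℚ) • (H V₀ V₄) + (1/2 : ℚ) • (HΔ V₄)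
    - (3/4 : ℚ) • (H V₄ V₄)

def b_ε₄_e : DoubleBurnside ℚ S₃ :=
  (1/6 : ℚ) • (H V₀ V₀) - (1/3 : ℚ) • (H V₁ V₀) - (1/6 : ℚ) • (H V₄ V₀) + (1/3 : ℚ) • (H V₅ V₀)

def b_ε₄_g : DoubleBurnside ℚ S₃ :=
  (-1/6 : ℚ) • (H V₀ V₀) + (1/3 : ℚ) • (H V₁ V₀) + (1/6 : ℚ) • (H V₀ V₁) + (1/6 : ℚ) • (H V₄ V₀)
    - (1/3 : ℚ) • (H V₁ V₁) - (1/3 : ℚ) • (H V₅ V₀) - (1/6 : ℚ) • (H V₄ V₁)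
    + (1/3 : ℚ) • (H V₅ V₁)

def b_ε₄_h : DoubleBurnside ℚ S₃ :=
  (1/24 : ℚ) • (H V₀ V₀) - (1/12 : ℚ) • (H V₁ V₀) - (1/6 : ℚ) • (H V₀ V₁) - (1/24 : ℚ) • (H V₄ V₀)
    + (1/8 : ℚ) • (H V₀ V₄) + (1/3 : ℚ) • (H V₁ V₁) + (1/12 : ℚ) • (H V₅ V₀)
    + (1/6 : ℚ) • (H V₄ V₁) - (1/4 : ℚ) • (H V₁ V₄) - (1/8 : ℚ) • (H V₄ V₄)
    - (1/3 : ℚ) • (H V₅ V₁) + (1/4 : ℚ) • (H V₅ V₄)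

def b_ε₄_ε₂ : DoubleBurnside ℚ S₃ :=
  (-1/2 : ℚ) • (H V₀ V₀) + (1/2 : ℚ) • (H V₁ V₀) + (1/2 : ℚ) • (H V₀ V₁) + (1/2 : ℚ) • (HΔ V₁)
    + (1/2 : ℚ) • (H V₄ V₀) - (H V₁ V₁) - (1/2 : ℚ) • (H V₅ V₀) - (1/2 : ℚ) • (H V₄ V₁)
    - (1/2 : ℚ) • H₇ + (H V₅ V₁)

def ε₄ : DoubleBurnside ℚ S₃ :=
  (1/2 : ℚ) • (H V₀ V₀) - (HΔ V₁) - (1/2 : ℚ) • (HΔ V₄) + (HΔ V₅)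

def b_ε₄_ε₄' : DoubleBurnside ℚ S₃ :=
  (1/24 : ℚ) • (H V₀ V₀) - (1/12 : ℚ) • (H V₁ V₀) - (1/12 : ℚ) • (H V₀ V₁)
    - (1/24 : ℚ) • (H V₄ V₀) - (1/24 : ℚ) • (H V₀ V₄) + (1/6 : ℚ) • (H V₁ V₁)
    + (1/12 : ℚ) • (H V₅ V₀) + (1/12 : ℚ) • (H V₀ V₅) + (1/12 : ℚ) • (H V₄ V₁)
    + (1/12 : ℚ) • (H V₁ V₄) + (1/24 : ℚ) • (H V₄ V₄) - (1/6 : ℚ) • (H V₁ V₅)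
    - (1/6 : ℚ) • (H V₅ V₁) - (1/12 : ℚ) • (H V₄ V₅) - (1/12 : ℚ) • (H V₅ V₄)
    + (1/6 : ℚ) • (H V₅ V₅)

def b_ε₄_ε₄'' : DoubleBurnside ℚ S₃ :=
  (1/4 : ℚ) • (H V₀ V₀) - (3/4 : ℚ) • (H V₁ V₀) - (3/4 : ℚ) • (H V₀ V₁) + (1/4 : ℚ) • (HΔ V₁)
    - (1/4 : ℚ) • (H V₄ V₀) - (1/4 : ℚ) • (H V₀ V₄) + (3/2 : ℚ) • (H V₁ V₁)
    + (3/4 : ℚ) • (H V₅ V₀) + (3/4 : ℚ) • (H V₀ V₅) - (1/4 : ℚ) • H₆ + (3/4 : ℚ) • (H V₄ V₁)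
    + (3/4 : ℚ) • (H V₁ V₄) - (1/4 : ℚ) • H₇ + (1/4 : ℚ) • (H V₄ V₄) - (3/2 : ℚ) • (H V₁ V₅)
    - (3/2 : ℚ) • (H V₅ V₁) - (3/4 : ℚ) • (H V₄ V₅) - (3/4 : ℚ) • (H V₅ V₄) + (1/4 : ℚ) • H₈
    + (3/2 : ℚ) • (H V₅ V₅)

/-- The map `γ : A → B_ℚ(S₃, S₃)`, given by the `ℚ`-linear bases of the Peirce components. -/
def gammaFun (a : PeirceAlg) : DoubleBurnside ℚ S₃ :=
  a.s 0 0 • elt_e + a.s 0 1 • b_e_g + a.s 0 2 • b_e_h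
    + a.s 1 0 • b_g_e + a.s 1 1 • elt_g + a.s 1 2 • b_g_h
    + a.s 2 0 • b_h_e + a.s 2 1 • b_h_g + a.s 2 2 • elt_h
    + a.t 0 • b_e_ε₄ + a.t 1 • b_g_ε₄ + a.t 2 • b_h_ε₄
    + a.u • ε₂ + a.v • b_ε₂_ε₄ + a.w • ε₃
    + a.x 0 • b_ε₄_e + a.x 1 • b_ε₄_g + a.x 2 • b_ε₄_h
    + a.y • b_ε₄_ε₂
    + a.z.fst • ε₄ + a.z.snd.1 • b_ε₄_ε₄' + a.z.snd.2 • b_ε₄_ε₄''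

end S₃

/-! ### The orders over `ℤ_(3)` -/

/-- The localization `ℤ_(3)`, as the subring of `ℚ` of the fractions with denominator prime
to `3`. -/
def Z₃ : Subring ℚ where
  carrier := {q | ¬ 3 ∣ q.den}
  one_mem' := by simp
  zero_mem' := by simp
  mul_mem' := by
    intro p q hp hq h
    rcases (Nat.Prime.dvd_mul Nat.prime_three).1 (h.trans (Rat.mul_den_dvd p q)) with h | h
    exacts [hp h, hq h]
  add_mem' := by
    intro p q hp hq h
    rcases (Nat.Prime.dvd_mul Nat.prime_three).1 (h.trans (Rat.add_den_dvd p q)) with h | h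
    exacts [hp h, hq h]
  neg_mem' := by
    intro p hp
    simpa using hp

namespace PeirceAlg

open Matrix EtaXi

/-- The order `A_R` of `A`, for `R = ℤ_(3)`: the elements all of whose entries and coefficients
lie in `R`. -/
def order : Subalgebra Z₃ PeirceAlg where
  carrier := {a | (∀ i j, a.s i j ∈ Z₃) ∧ (∀ i, a.t i ∈ Z₃) ∧ a.u ∈ Z₃ ∧ a.v ∈ Z₃ ∧ a.w ∈ Z₃ ∧
    (∀ i, a.x i ∈ Z₃) ∧ a.y ∈ Z₃ ∧ a.z.fst ∈ Z₃ ∧ a.z.snd.1 ∈ Z₃ ∧ a.z.snd.2 ∈ Z₃}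
  mul_mem' := by
    rintro a b ⟨hs, ht, hu, hv, hw, hx, hy, hz, hz', hz''⟩
      ⟨ks, kt, ku, kv, kw, kx, ky, kz, kz', kz''⟩
    have h12 : (12 : ℚ) ∈ Z₃ := by exact_mod_cast natCast_mem Z₃ 12
    refine ⟨fun i j => ?_, fun i => ?_, mul_mem hu ku, add_mem (mul_mem hu kv) (mul_mem hv kz),
      mul_mem hw kw, fun i => ?_, add_mem (mul_mem hy ku) (mul_mem hz ky), ?_, ?_, ?_⟩
    · simp only [mul_s, Matrix.mul_apply]
      exact sum_mem fun k _ => mul_mem (hs i k) (ks k j)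
    · simp only [mul_t, Pi.add_apply, mulVec, dotProduct, Pi.smul_apply, smul_eq_mul]
      exact add_mem (sum_mem fun k _ => mul_mem (hs i k) (kt k)) (mul_mem kz (ht i))
    · simp only [mul_x, Pi.add_apply, vecMul, dotProduct, Pi.smul_apply, smul_eq_mul]
      exact add_mem (sum_mem fun k _ => mul_mem (hx k) (ks k i)) (mul_mem hz (kx i))
    · rw [fst_mul_z]
      exact mul_mem hz kz
    · have hd : a.x ⬝ᵥ b.t ∈ Z₃ := sum_mem fun k _ => mul_mem (hx k) (kt k)
      have : (a * b).z.snd.1 = a.x ⬝ᵥ b.t - 12 * (a.y * b.v) + a.z.fst * b.z.snd.1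
          + b.z.fst * a.z.snd.1 := by
        simp [η, ξ]; ring
      rw [this]
      exact add_mem (add_mem (sub_mem hd (mul_mem h12 (mul_mem hy kv))) (mul_mem hz kz'))
        (mul_mem kz hz')
    · have : (a * b).z.snd.2 = a.y * b.v + a.z.fst * b.z.snd.2 + b.z.fst * a.z.snd.2 := by
        simp [η, ξ]; ring
      rw [this]
      exact add_mem (add_mem (mul_mem hy kv) (mul_mem hz kz'')) (mul_mem kz hz'')
  add_mem' := by
    rintro a b ⟨hs, ht, hu, hv, hw, hx, hy, hz, hz', hz''⟩
      ⟨ks, kt, ku, kv, kw, kx, ky, kz, kz', kz''⟩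
    exact ⟨fun i j => add_mem (hs i j) (ks i j), fun i => add_mem (ht i) (kt i), add_mem hu ku,
      add_mem hv kv, add_mem hw kw, fun i => add_mem (hx i) (kx i), add_mem hy ky,
      add_mem hz kz, add_mem hz' kz', add_mem hz'' kz''⟩
  algebraMap_mem' := by
    intro r
    have h : algebraMap Z₃ PeirceAlg r = (r : ℚ) • (1 : PeirceAlg) :=
      Algebra.algebraMap_eq_smul_one (r : ℚ)
    have h1 : ∀ i j, (1 : Matrix (Fin 3) (Fin 3) ℚ) i j ∈ Z₃ := fun i j => by
      rw [Matrix.one_apply]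
      split_ifs
      exacts [one_mem _, zero_mem _]
    rw [h]
    refine ⟨fun i j => mul_mem r.2 (h1 i j), ?_⟩
    simp [r.2, zero_mem]

variable (γ : PeirceAlg ≃ₐ[ℚ] DoubleBurnside ℚ S₃)

/-- Given an isomorphism `γ`, the ring morphism `δ : B_ℤ(S₃, S₃) → A`,
`y ↦ x₃⁻¹ x₂⁻¹ x₁⁻¹ γ⁻¹(y) x₁ x₂ x₃`. -/
def delta : DoubleBurnside ℤ S₃ →+* PeirceAlg :=
  ((MulSemiringAction.toRingHom (ConjAct PeirceAlgˣ) PeirceAlg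
      (ConjAct.toConjAct (x₁ * x₂ * x₃)⁻¹)).comp (γ.symm : DoubleBurnside ℚ S₃ →+* PeirceAlg)).comp
    (DoubleBurnside.mapCoeff (Int.castRingHom ℚ) S₃)

theorem delta_apply (y : DoubleBurnside ℤ S₃) :
    delta γ y = ↑x₃⁻¹ * ↑x₂⁻¹ * ↑x₁⁻¹ *
      γ.symm (DoubleBurnside.mapCoeff (Int.castRingHom ℚ) S₃ y) * x₁ * x₂ * x₃ := by
  simp [delta, ConjAct.units_smul_def, mul_assoc]

/-- The image `Λ = δ(B_ℤ(S₃, S₃))`. -/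
def Lambda : Subring PeirceAlg := (delta γ).range

/-- The localization `Λ_(3) = ℤ_(3) Λ` of `Λ` inside `A`: the `ℤ_(3)`-linear span of `Λ`. -/
def LambdaLoc : Subalgebra Z₃ PeirceAlg :=
  (Submodule.span Z₃ (Lambda γ : Set PeirceAlg)).toSubalgebra
    (Submodule.subset_span (one_mem (Lambda γ)))
    (fun a b ha hb => by
      have h := Submodule.mul_mem_mul ha hb
      rw [Submodule.span_mul_span] at h
      refine Submodule.span_mono ?_ h
      rintro _ ⟨p, hp, q, hq, rfl⟩
      exact mul_mem hp hq)

end PeirceAlg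

/-- The congruence `q ≡ 0` modulo `3` in `ℤ_(3)`. -/
def ZeroModThree (q : ℚ) : Prop := ∃ r ∈ Z₃, q = 3 * r

end

/-! Put G = S₃. By the Mackey formula, the product of (G × G)/U and (G × G)/V over G is the disjoint
union, over double cosets p₂(U) g p₁(V), of the bisets (G × G)/(U * ᵍV). Here p₁, p₂ are the
projections, * is composition of relations, and ᵍV is V conjugated by (g, 1). A conjugation
invariant function d on subgroups of G × G that satisfies this formula inside an algebra, with value
1 at the diagonal, therefore gives an algebra morphism on the double Burnside algebra: [M] goes to
the sum of d over the stabilizers of the orbits of M.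

The proof runs in the direction opposite to γ. The values d(U) = δ([(G × G)/U]) are given as a table
of 22 integer vectors, one for each conjugacy class, and the Mackey formula is verified for this
table (`isMackey_deltaCoset`). Representatives of double cosets are avoided by averaging. The double
coset of g has |U||V|/t(g) elements, where t(g) counts the triples (x, y, z) with (x, y) ∈ U and (y,
z) ∈ ᵍV. So the formula becomes |U||V| d(U) d(V) = ∑ t(g) d(U * ᵍV), summed over all g in G.
Correspondingly, sums over orbits are replaced by weighted sums over points, and multiplicativity
becomes a double count (`sum_fiber_triples`, `weightedSum_tensor`).

Two finite inputs make the check possible: the classification of the subgroups of S₃ × S₃ up to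
conjugacy (`exists_eq_pairConj_rep`), and a conjugation invariant weight that separates the 22
classes, so that the class of a composition is found by a computation.

The 22 × 22 matrix D of the table satisfies D B = 24 for an integer matrix B. Hence the morphism is
bijective over ℚ. Its composite with conjugation by the units inverts γ, as is seen on the standard
basis of A. For the localization, the columns of D for the coordinates x₁, x₂, x₃, z₂ are divisible
by 3, and so are the rows of B for all other coordinates; as 24 = 3 · 8 with 8 a unit in ℤ_(3),
these four congruences are exactly the conditions for membership. Independence of the 22 vectors
also gives injectivity over ℤ_(3). -/

noncomputable section

/-! ### Subgroups of G × G as relations on G -/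

open scoped Classical in
/-- The indicator function of a subgroup of `G × G`, as a relation on `G`. -/
def Subgroup.ind {G : Type} [Group G] (U : Subgroup (G × G)) (x y : G) : ℕ :=
  if (x, y) ∈ U then 1 else 0

/-- The conjugate of a subgroup of `G × G` by `(g, k)`. -/
def Subgroup.pairConj {G : Type} [Group G] (g k : G) (U : Subgroup (G × G)) :
    Subgroup (G × G) where
  carrier := {p | (g⁻¹ * p.1 * g, k⁻¹ * p.2 * k) ∈ U}
  one_mem' := by
    change (g⁻¹ * (1 : G) * g, k⁻¹ * (1 : G) * k) ∈ U
    rw [mul_one, mul_one, inv_mul_cancel, inv_mul_cancel]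
    exact U.one_mem
  mul_mem' := by
    rintro ⟨x, y⟩ ⟨x', y'⟩ hp hq
    simpa [mul_assoc] using U.mul_mem hp hq
  inv_mem' := by
    rintro ⟨x, y⟩ hp
    simpa [mul_assoc] using U.inv_mem hp

/-- The composition of two subgroups of `G × G`, regarded as relations on `G`. -/
def Subgroup.relComp {G : Type} [Group G] (U V : Subgroup (G × G)) : Subgroup (G × G) where
  carrier := {p | ∃ y, (p.1, y) ∈ U ∧ (y, p.2) ∈ V}
  one_mem' := ⟨1, U.one_mem, V.one_mem⟩
  mul_mem' := by
    rintro p q ⟨y, hU, hV⟩ ⟨y', hU', hV'⟩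
    exact ⟨y * y', U.mul_mem hU hU', V.mul_mem hV hV'⟩
  inv_mem' := by
    rintro p ⟨y, hU, hV⟩
    exact ⟨y⁻¹, U.inv_mem hU, V.inv_mem hV⟩

namespace Subgroup

variable {G : Type} [Group G]

theorem mem_pairConj {g k x y : G} {U : Subgroup (G × G)} :
    (x, y) ∈ U.pairConj g k ↔ (g⁻¹ * x * g, k⁻¹ * y * k) ∈ U := Iff.rfl

theorem mem_relComp {x z : G} {U V : Subgroup (G × G)} :
    (x, z) ∈ U.relComp V ↔ ∃ y, (x, y) ∈ U ∧ (y, z) ∈ V := Iff.rfl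

theorem pairConj_pairConj (g k g' k' : G) (U : Subgroup (G × G)) :
    (U.pairConj g k).pairConj g' k' = U.pairConj (g' * g) (k' * k) := by
  ext ⟨x, y⟩
  simp [mem_pairConj, mul_assoc]

theorem pairConj_one (U : Subgroup (G × G)) : U.pairConj 1 1 = U := by
  ext ⟨x, y⟩
  simp [mem_pairConj]

theorem ind_pairConj (g k x y : G) (U : Subgroup (G × G)) :
    (U.pairConj g k).ind x y = U.ind (g⁻¹ * x * g) (k⁻¹ * y * k) := rfl

/-- Conjugating the middle variable y by k moves the conjugation from the second entry of U to the
first entry of V. The same substitution proves `triples_pairConj_left`. -/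
theorem relComp_pairConj_left (g k : G) (U V : Subgroup (G × G)) :
    (U.pairConj g k).relComp V = (U.relComp (V.pairConj k⁻¹ 1)).pairConj g 1 := by
  ext ⟨x, z⟩
  simp only [mem_relComp, mem_pairConj]
  constructor
  · rintro ⟨y, h, h'⟩
    exact ⟨k⁻¹ * y * k, h, by simpa [mul_assoc] using h'⟩
  · rintro ⟨y, h, h'⟩
    exact ⟨k * y * k⁻¹, by simpa [mul_assoc] using h, by simpa [mul_assoc] using h'⟩

theorem relComp_pairConj_right (k : G) (U V : Subgroup (G × G)) :
    U.relComp (V.pairConj 1 k) = (U.relComp V).pairConj 1 k := by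
  ext ⟨x, z⟩
  simp [mem_relComp, mem_pairConj]

variable [Fintype G]

/-- The order of a subgroup of `G × G`. -/
def size (U : Subgroup (G × G)) : ℕ := ∑ x, ∑ y, U.ind x y

/-- The number of triples `(x, y, z)` with `(x, y) ∈ U` and `(y, z) ∈ V`. -/
def triples (U V : Subgroup (G × G)) : ℕ := ∑ y, (∑ x, U.ind x y) * ∑ z, V.ind y z

theorem sum_conj {A : Type*} [AddCommMonoid A] (g : G) (F : G → A) :
    ∑ x, F (g⁻¹ * x * g) = ∑ x, F x := by
  simpa using Equiv.sum_comp (MulAut.conj g⁻¹).toEquiv F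

theorem size_pairConj (g k : G) (U : Subgroup (G × G)) : (U.pairConj g k).size = U.size := by
  simp only [size, ind_pairConj]
  rw [← sum_conj g (fun x => ∑ y, U.ind x y)]
  exact Finset.sum_congr rfl fun x _ => sum_conj k (fun y => U.ind _ y)

theorem size_eq_card (U : Subgroup (G × G)) : U.size = Nat.card U := by
  classical
  rw [size, ← Fintype.sum_prod_type' (f := fun x y => U.ind x y), Nat.card_eq_fintype_card,
    Fintype.card_subtype, Finset.card_filter]
  rfl

theorem triples_pairConj_left (g k : G) (U V : Subgroup (G × G)) :
    (U.pairConj g k).triples V = U.triples (V.pairConj k⁻¹ 1) := by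
  simp only [triples, ind_pairConj]
  rw [← sum_conj k (fun y => (∑ x, U.ind x y) * _)]
  refine Finset.sum_congr rfl fun y _ => ?_
  rw [sum_conj g (fun x => U.ind x _)]
  simp [mul_assoc]

theorem triples_pairConj_right (k : G) (U V : Subgroup (G × G)) :
    U.triples (V.pairConj 1 k) = U.triples V := by
  simp only [triples, ind_pairConj]
  refine Finset.sum_congr rfl fun y _ => ?_
  rw [sum_conj k (fun x => V.ind _ x)]
  simp

end Subgroup

/-- A conjugation invariant function `d` on the subgroups of `G × G` with values in a
`ℚ`-algebra that satisfies the averaged Mackey formula. -/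
structure IsMackey {G : Type} [Group G] [Fintype G] {A : Type} [Ring A] [Algebra ℚ A]
    (d : Subgroup (G × G) → A) : Prop where
  conj : ∀ U g k, d (U.pairConj g k) = d U
  -- The summand depends only on the double coset p₂(U) g p₁(V), which has |U||V| / triples
  -- elements; division by |U||V| gives the usual sum over double cosets.
  mackey : ∀ U V, (U.size * V.size) • (d U * d V) =
    ∑ g : G, U.triples (V.pairConj g 1) • d (U.relComp (V.pairConj g 1))
  diag : ∀ U, (∀ x y, (x, y) ∈ U ↔ x = y) → d U = 1

/-! ### Counting transporters on an orbit -/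

namespace MulAction

/-- The number of group elements that transport a point to another point of its orbit. -/
theorem sum_card_transporter {G Z : Type} [Group G] [Fintype G] [MulAction G Z] [Fintype Z]
    [DecidableEq Z] (P : Z → Prop) [DecidablePred P] (q₀ : Z)
    (hP : ∀ q, P q ↔ ∃ g : G, q = g • q₀) (σ : Z → Z)
    (hσ : ∀ q, P q → P (σ q)) :
    ∑ q, (if P q then ∑ k : G, (if k • q = σ q then 1 else 0) else 0) = Fintype.card G := by
  classical
  set n := Nat.card (stabilizer G q₀) with hn
  have hstab : ∀ q, P q → ∑ k : G, (if k • q = σ q then 1 else 0) = n := by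
    intro q hq
    obtain ⟨g, rfl⟩ := (hP q).1 hq
    obtain ⟨l, hl⟩ := (hP _).1 (hσ _ hq)
    rw [hl, hn, Nat.card_eq_fintype_card, Fintype.card_subtype, Finset.card_filter]
    -- With q = g q₀ and σ q = l q₀, the element k transports q to σ q exactly when l⁻¹ k g fixes
    -- q₀.
    refine Fintype.sum_equiv ((Equiv.mulRight g).trans (Equiv.mulLeft l⁻¹)) _ _ fun k => ?_
    simp only [Equiv.trans_apply, Equiv.coe_mulRight, Equiv.coe_mulLeft, mem_stabilizer_iff]
    congr 1
    rw [mul_smul, mul_smul, inv_smul_eq_iff]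
  have h : ∀ q, (if P q then ∑ k : G, (if k • q = σ q then 1 else 0) else 0) =
      (if P q then 1 else 0) * n := by
    intro q
    split_ifs with hq
    · rw [hstab q hq, one_mul]
    · rw [zero_mul]
  rw [Finset.sum_congr rfl fun q _ => h q, ← Finset.sum_mul, ← Finset.card_filter]
  have ho : (Finset.univ.filter P).card = Nat.card (orbit G q₀) := by
    rw [Nat.card_eq_fintype_card, Fintype.card_subtype]
    congr 1
    ext q
    simp [hP, mem_orbit_iff, eq_comm]
  rw [ho, hn, ← Nat.card_prod, Nat.card_congr (orbitProdStabilizerEquivGroup G q₀),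
    Nat.card_eq_fintype_card]

end MulAction

/-! ### Stabilizers, and multiplicativity of orbit sums -/

namespace Biset

variable {G : Type} [Group G]

/-- The stabilizer of a point of a biset under `(h, g) · m = h m g⁻¹`. -/
def stab (M : Biset G) (m : M.carrier) : Subgroup (G × G) where
  carrier := {p | p.1 • m = MulOpposite.op p.2 • m}
  one_mem' := by
    change (1 : G) • m = MulOpposite.op (1 : G) • m
    simp
  mul_mem' := by
    rintro ⟨h, g⟩ ⟨h', g'⟩ (hp : h • m = MulOpposite.op g • m)
      (hq : h' • m = MulOpposite.op g' • m)
    change (h * h') • m = MulOpposite.op (g * g') • m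
    rw [mul_smul, hq, smul_comm, hp, smul_smul, MulOpposite.op_mul]
  inv_mem' := by
    rintro ⟨h, g⟩ (hp : h • m = MulOpposite.op g • m)
    change h⁻¹ • m = MulOpposite.op g⁻¹ • m
    rw [inv_smul_eq_iff, smul_comm, hp, smul_smul]
    simp

theorem mem_stab {M : Biset G} {m : M.carrier} {h g : G} :
    (h, g) ∈ M.stab m ↔ h • m = MulOpposite.op g • m := Iff.rfl

theorem stab_smul (M : Biset G) (m : M.carrier) (h g : G) :
    M.stab (h • MulOpposite.op g⁻¹ • m) = (M.stab m).pairConj h g := by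
  ext ⟨x, y⟩
  have h1 : x • h • MulOpposite.op g⁻¹ • m =
      h • MulOpposite.op g⁻¹ • (h⁻¹ * x * h) • m := by
    rw [← smul_comm (h⁻¹ * x * h), smul_smul, smul_smul]
    group
  have h2 : MulOpposite.op y • h • MulOpposite.op g⁻¹ • m =
      h • MulOpposite.op g⁻¹ • MulOpposite.op (g⁻¹ * y * g) • m := by
    rw [← smul_comm h]
    simp [smul_smul, mul_assoc]
  rw [mem_stab, Subgroup.mem_pairConj, mem_stab, h1, h2, smul_left_cancel_iff,
    smul_left_cancel_iff]

theorem stab_smul_left (M : Biset G) (m : M.carrier) (h : G) :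
    M.stab (h • m) = (M.stab m).pairConj h 1 := by
  simpa using M.stab_smul m h 1

/-- The equality of x m ⊗ n and m ⊗ n z provides a group element that carries one representing pair
to the other; this element is the intermediate y of the composed relation. -/
theorem stab_tmk {M N : Biset G} (m : M.carrier) (n : N.carrier) :
    (tensor M N).stab (tmk m n) = (M.stab m).relComp (N.stab n) := by
  ext ⟨x, z⟩
  rw [mem_stab, smul_tmk, op_smul_tmk, Subgroup.mem_relComp]
  constructor
  · intro h
    obtain ⟨g, hg⟩ := Quotient.exact h
    obtain ⟨h1, h2⟩ := Prod.ext_iff.1 hg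
    refine ⟨g, ?_, ?_⟩
    · change m = MulOpposite.op g⁻¹ • x • m at h1
      rw [mem_stab]
      conv_rhs => rw [h1]
      simp [smul_smul]
    · exact h2.symm
  · rintro ⟨y, h1, h2⟩
    rw [mem_stab] at h1 h2
    rw [h1, tmk_eq, h2]

section Coset

variable [Finite G]

/-- The base point of the transitive biset `(G × G) / U`. -/
def cosetBase (U : Subgroup (G × G)) : (coset U).carrier := QuotientGroup.mk (s := U) 1

theorem stab_cosetBase (U : Subgroup (G × G)) : (coset U).stab (cosetBase U) = U := by
  ext ⟨x, y⟩
  rw [mem_stab]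
  change QuotientGroup.mk (s := U) ((x, (1 : G)) * 1) =
    QuotientGroup.mk (s := U) (((1 : G), y⁻¹) * 1) ↔ _
  rw [QuotientGroup.eq]
  simp [← U.inv_mem_iff (x := (x, y))]

theorem coset_transitive (U : Subgroup (G × G)) (m : (coset U).carrier) :
    ∃ x y : G, m = x • MulOpposite.op y⁻¹ • cosetBase U := by
  obtain ⟨⟨x, y⟩, rfl⟩ := QuotientGroup.mk_surjective (s := U) m
  refine ⟨x, y, ?_⟩
  change _ = QuotientGroup.mk (s := U) ((x, (1 : G)) * ((1, y⁻¹⁻¹) * 1))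
  simp

end Coset

instance (M : Biset G) : Fintype M.carrier := Fintype.ofFinite _

instance (M N : Biset G) : Fintype (tensor M N).carrier := Fintype.ofFinite _

variable [Fintype G] {A : Type} [Ring A]

/-- The sum of `d` over the stabilizers of the points of `M`, weighted by their orders. -/
def weightedSum (d : Subgroup (G × G) → A) (M : Biset G) : A :=
  ∑ m, (M.stab m).size • d (M.stab m)

theorem weightedSum_congr (d : Subgroup (G × G) → A) {M N : Biset G} (h : Iso M N) :
    weightedSum d M = weightedSum d N := by
  obtain ⟨f, hl, hr⟩ := h
  refine Fintype.sum_equiv f _ _ fun m => ?_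
  have : N.stab (f m) = M.stab m := by
    ext ⟨x, y⟩
    rw [mem_stab, mem_stab, ← hl, ← hr, f.apply_eq_iff_eq]
  rw [this]

theorem weightedSum_sum (d : Subgroup (G × G) → A) (M N : Biset G) :
    weightedSum d (M.sum N) = weightedSum d M + weightedSum d N := by
  have hl : ∀ m : M.carrier, (M.sum N).stab (Sum.inl m) = M.stab m := by
    intro m
    ext ⟨x, y⟩
    exact Sum.inl_injective.eq_iff
  have hr : ∀ n : N.carrier, (M.sum N).stab (Sum.inr n) = N.stab n := by
    intro n
    ext ⟨x, y⟩
    exact Sum.inr_injective.eq_iff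
  have h : ∀ F : (M.sum N).carrier → A,
      ∑ m, F m = ∑ m : M.carrier, F (Sum.inl m) + ∑ n : N.carrier, F (Sum.inr n) := by
    intro F
    have h : ∀ _ : Fintype (M.carrier ⊕ N.carrier), ∀ F : M.carrier ⊕ N.carrier → A,
        ∑ m, F m = ∑ m : M.carrier, F (Sum.inl m) + ∑ n : N.carrier, F (Sum.inr n) := by
      intro _ F
      rw [← Fintype.sum_sum_type F]
      congr 1
      exact congrArg _ (Subsingleton.elim _ _)
    exact h _ F
  rw [weightedSum, h]
  simp only [hl, hr]
  rfl

variable [Algebra ℚ A]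

/-- The sum of the values of `d` over the orbits of `M`, as an average over the points of `M`. -/
def orbitSum (d : Subgroup (G × G) → A) (M : Biset G) : A :=
  ((Fintype.card G : ℚ) ^ 2)⁻¹ • weightedSum d M

/-- The action of `G` on `M × N` whose orbits form the tensor product. -/
abbrev tensorAction (M N : Biset G) : MulAction G (M.carrier × N.carrier) where
  smul g p := (MulOpposite.op g⁻¹ • p.1, g • p.2)
  one_smul p := by
    change (MulOpposite.op (1 : G)⁻¹ • p.1, (1 : G) • p.2) = p
    simp
  mul_smul g k p := by
    change (MulOpposite.op (g * k)⁻¹ • p.1, (g * k) • p.2) =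
      (MulOpposite.op g⁻¹ • MulOpposite.op k⁻¹ • p.1, g • k • p.2)
    simp [smul_smul]

-- A double count: the fibre over p is one orbit of G on M × N. For fixed (x, z) in the stabilizer
-- of p, the y with x m = m y and y n = n z are the inverses of the elements that transport (m, n)
-- to (x m, n z⁻¹), again a point of the fibre. By orbit-stabilizer there are |G| such pairs of a
-- point and a y.
open scoped Classical in
theorem sum_fiber_triples {M N : Biset G} (p : (tensor M N).carrier) :
    ∑ m, ∑ n, (if tmk m n = p then (M.stab m).triples (N.stab n) else 0) =
      Fintype.card G * ((tensor M N).stab p).size := by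
  induction p using tensor_ind with | h m₀ n₀ => ?_
  have key : ∀ x z : G, ∑ q : M.carrier × N.carrier, (if tmk q.1 q.2 = tmk m₀ n₀ then
      ∑ y, (M.stab q.1).ind x y * (N.stab q.2).ind y z else 0) =
      Fintype.card G * ((tensor M N).stab (tmk m₀ n₀)).ind x z := by
    intro x z
    unfold Subgroup.ind
    split_ifs with hxz
    · let _ := tensorAction M N
      rw [mul_one, ← MulAction.sum_card_transporter (G := G)
        (fun q : M.carrier × N.carrier => tmk q.1 q.2 = tmk m₀ n₀) (m₀, n₀) ?_
        (fun q => (x • q.1, MulOpposite.op z⁻¹ • q.2)) ?_]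
      · refine Finset.sum_congr rfl fun q _ => ?_
        congr 1
        -- In the action on M × N, it is y⁻¹ that maps (m, n) to (m y, y⁻¹ n).
        refine Fintype.sum_equiv (Equiv.inv G) _ _ fun y => ?_
        rw [ite_zero_mul_ite_zero, mul_one]
        refine if_congr ?_ rfl rfl
        change _ ↔ (MulOpposite.op y⁻¹⁻¹ • q.1, y⁻¹ • q.2) = _
        rw [mem_stab, mem_stab, Prod.mk_inj, inv_inv, eq_comm]
        refine and_congr Iff.rfl ?_
        rw [inv_smul_eq_iff, smul_comm, MulOpposite.op_inv, eq_inv_smul_iff, eq_comm]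
      · intro q
        constructor
        · intro h
          exact Quotient.exact h.symm
        · rintro ⟨g, h⟩
          exact (Quotient.sound ⟨g, h⟩ : tmk m₀ n₀ = tmk q.1 q.2).symm
      · intro q hq
        change tmk (x • q.1) (MulOpposite.op z⁻¹ • q.2) = tmk m₀ n₀
        rw [← smul_tmk, ← op_smul_tmk, hq, smul_comm, mem_stab.1 hxz, smul_smul]
        simp
    · rw [mul_zero]
      refine Finset.sum_eq_zero fun q _ => ?_
      split_ifs with hq
      · refine Finset.sum_eq_zero fun y _ => ?_
        rw [ite_zero_mul_ite_zero, if_neg]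
        rintro ⟨h1, h2⟩
        refine hxz ?_
        rw [← hq, stab_tmk]
        exact ⟨y, h1, h2⟩
      · rfl
  have h : ∀ q : M.carrier × N.carrier, (M.stab q.1).triples (N.stab q.2) =
      ∑ x, ∑ z, ∑ y, (M.stab q.1).ind x y * (N.stab q.2).ind y z := by
    intro q
    simp only [Subgroup.triples, Finset.sum_mul_sum]
    rw [Finset.sum_comm]
    exact Finset.sum_congr rfl fun x _ => Finset.sum_comm
  rw [← Fintype.sum_prod_type' (f := fun m n =>
    (if tmk m n = tmk m₀ n₀ then (M.stab m).triples (N.stab n) else 0))]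
  simp only [h, Subgroup.size, Finset.mul_sum, ← key]
  rw [Finset.sum_congr rfl fun x _ => Finset.sum_comm, Finset.sum_comm]
  refine Finset.sum_congr rfl fun q _ => ?_
  split_ifs
  · rfl
  · simp

/-- The averaged Mackey formula is summed over all pairs of points. For each g the substitution n ↦
g n removes the conjugation, which yields one factor |G|; the other comes from `sum_fiber_triples`.
-/
theorem weightedSum_tensor {d : Subgroup (G × G) → A} (hd : IsMackey d) (M N : Biset G) :
    weightedSum d M * weightedSum d N =
      (Fintype.card G * Fintype.card G) • weightedSum d (tensor M N) := by
  classical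
  have h1 : (Fintype.card G) • weightedSum d (tensor M N) =
      ∑ m, ∑ n, (M.stab m).triples (N.stab n) • d ((M.stab m).relComp (N.stab n)) := by
    simp only [weightedSum, Finset.smul_sum, ← mul_smul, ← sum_fiber_triples, Finset.sum_smul]
    rw [Finset.sum_comm]
    refine Finset.sum_congr rfl fun m _ => ?_
    rw [Finset.sum_comm]
    refine Finset.sum_congr rfl fun n _ => ?_
    rw [Finset.sum_eq_single (tmk m n)]
    · rw [if_pos rfl, stab_tmk]
    · intro p _ hp
      rw [if_neg hp.symm, zero_smul]
    · simp
  have h2 : ∀ m, ∀ g : G, ∑ n, (M.stab m).triples ((N.stab n).pairConj g 1) •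
        d ((M.stab m).relComp ((N.stab n).pairConj g 1)) =
      ∑ n, (M.stab m).triples (N.stab n) • d ((M.stab m).relComp (N.stab n)) := by
    intro m g
    refine Fintype.sum_equiv (MulAction.toPerm g) _ _ fun n => ?_
    rw [MulAction.toPerm_apply, stab_smul_left]
  rw [mul_smul, h1, weightedSum, weightedSum, Finset.sum_mul_sum, Finset.smul_sum]
  refine Finset.sum_congr rfl fun m _ => ?_
  simp only [smul_mul_smul_comm, hd.mackey]
  rw [Finset.sum_comm, Finset.sum_congr rfl fun g _ => h2 m g, Finset.sum_const,
    Finset.card_univ]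

theorem weightedSum_of_transitive {d : Subgroup (G × G) → A} (hd : IsMackey d) (M : Biset G)
    (m₀ : M.carrier) (h : ∀ m, ∃ x y : G, m = x • MulOpposite.op y⁻¹ • m₀) :
    weightedSum d M = (Fintype.card M.carrier * (M.stab m₀).size) • d (M.stab m₀) := by
  rw [weightedSum, Finset.sum_congr rfl (g := fun _ => (M.stab m₀).size • d (M.stab m₀)),
    Finset.sum_const, Finset.card_univ, mul_smul]
  intro m _
  obtain ⟨x, y, rfl⟩ := h m
  rw [stab_smul, hd.conj, Subgroup.size_pairConj]

/-- All points have stabilizers conjugate to U, and the number of points times |U| is |G|². This is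
why the normalization by |G|² lets each orbit count once. -/
theorem orbitSum_coset {d : Subgroup (G × G) → A} (hd : IsMackey d) (U : Subgroup (G × G)) :
    orbitSum d (coset U) = d U := by
  have h : Fintype.card (coset U).carrier * U.size = Fintype.card G ^ 2 := by
    rw [Subgroup.size_eq_card, ← Nat.card_eq_fintype_card, sq, ← Fintype.card_prod,
      ← Nat.card_eq_fintype_card]
    exact (Subgroup.card_eq_card_quotient_mul_card_subgroup U).symm
  rw [orbitSum, weightedSum_of_transitive hd _ _ (coset_transitive U), stab_cosetBase, h,
    ← Nat.cast_smul_eq_nsmul ℚ, Nat.cast_pow, inv_smul_smul₀]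
  simp

/-- The neutral element as a point of the biset `G`. -/
def selfBase (G : Type) [Group G] [Finite G] : (self G).carrier := (1 : G)

theorem orbitSum_self {d : Subgroup (G × G) → A} (hd : IsMackey d) :
    orbitSum d (self G) = 1 := by
  have hm : ∀ x y : G, (x, y) ∈ (self G).stab (selfBase G) ↔ x = y := by
    intro x y
    rw [mem_stab]
    change x * (1 : G) = (1 : G) * y ↔ _
    simp
  have hs : ((self G).stab (selfBase G)).size = Fintype.card G := by
    classical
    simp [Subgroup.size, Subgroup.ind, hm]
  have hc : Fintype.card (self G).carrier = Fintype.card G := by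
    rw [← Nat.card_eq_fintype_card, ← Nat.card_eq_fintype_card]
    rfl
  rw [orbitSum, weightedSum_of_transitive hd _ (selfBase G), hd.diag _ hm, hs, hc, ← sq,
    ← Nat.cast_smul_eq_nsmul ℚ, Nat.cast_pow, inv_smul_smul₀]
  · simp
  · intro (g : G)
    refine ⟨g, 1, ?_⟩
    change g = g * ((1 : G) * (1 : G)⁻¹)
    simp

theorem orbitSum_tensor {d : Subgroup (G × G) → A} (hd : IsMackey d) (M N : Biset G) :
    orbitSum d (tensor M N) = orbitSum d M * orbitSum d N := by
  have h : (Fintype.card G : ℚ) ≠ 0 := by simp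
  rw [orbitSum, orbitSum, orbitSum, smul_mul_smul_comm, weightedSum_tensor hd,
    ← Nat.cast_smul_eq_nsmul ℚ, smul_smul]
  congr 1
  push_cast
  field_simp

/-- The orbit sum as a multiplicative function on isomorphism classes of bisets. -/
def orbitSumHom {d : Subgroup (G × G) → A} (hd : IsMackey d) : BisetClass G →* A where
  toFun := Quotient.lift (orbitSum d) fun M N (h : Iso M N) => by
    rw [orbitSum, orbitSum, weightedSum_congr d h]
  map_one' := orbitSum_self hd
  map_mul' := by
    rintro ⟨M⟩ ⟨N⟩
    exact orbitSum_tensor hd M N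

theorem orbitSumHom_mk {d : Subgroup (G × G) → A} (hd : IsMackey d) (M : Biset G) :
    orbitSumHom hd (BisetClass.mk M) = orbitSum d M := rfl

end Biset

/-! ### The algebra morphism given by orbit sums -/

namespace DoubleBurnside

variable {G : Type} [Group G] [Fintype G] {A : Type} [Ring A] [Algebra ℚ A]

/-- The algebra morphism on the double Burnside algebra that maps `[M]` to its orbit sum. -/
def orbitSumAlgHom (R : Type) [CommRing R] [Algebra R A] {d : Subgroup (G × G) → A}
    (hd : IsMackey d) : DoubleBurnside R G →ₐ[R] A :=
  RingQuot.liftAlgHom R ⟨MonoidAlgebra.lift R A _ (Biset.orbitSumHom hd), by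
    rintro _ _ ⟨M, N⟩
    simp only [map_add, MonoidAlgebra.lift_of, Biset.orbitSumHom_mk, Biset.orbitSum,
      Biset.weightedSum_sum, smul_add]⟩

theorem orbitSumAlgHom_cls (R : Type) [CommRing R] [Algebra R A] {d : Subgroup (G × G) → A}
    (hd : IsMackey d) (M : Biset G) : orbitSumAlgHom R hd (cls R M) = Biset.orbitSum d M := by
  rw [orbitSumAlgHom, cls, RingQuot.liftAlgHom_mkAlgHom_apply, MonoidAlgebra.lift_of,
    Biset.orbitSumHom_mk]

end DoubleBurnside

end

/-! ### Generation by transitive bisets -/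

noncomputable section

namespace Biset

variable {G : Type} [Group G]

/-- The restriction of a biset to a subset that is stable under both actions. -/
def restrict (M : Biset G) (S : Set M.carrier) (hl : ∀ (h : G), ∀ m ∈ S, h • m ∈ S)
    (hr : ∀ (g : Gᵐᵒᵖ), ∀ m ∈ S, g • m ∈ S) : Biset G where
  carrier := S
  left :=
    { smul := fun h m => ⟨h • m.1, hl h _ m.2⟩
      one_smul := fun m => Subtype.ext (one_smul G m.1)
      mul_smul := fun h k m => Subtype.ext (mul_smul h k m.1) }
  right :=
    { smul := fun g m => ⟨g • m.1, hr g _ m.2⟩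
      one_smul := fun m => Subtype.ext (one_smul Gᵐᵒᵖ m.1)
      mul_smul := fun h k m => Subtype.ext (mul_smul h k m.1) }
  comm := @SMulCommClass.mk _ _ _ (_) (_) fun h g m => Subtype.ext (smul_comm h g m.1)

theorem iso_sum_restrict (M : Biset G) (S : Set M.carrier) (hl hr) (hl' hr') :
    Iso ((M.restrict S hl hr).sum (M.restrict Sᶜ hl' hr')) M := by
  classical
  refine ⟨Equiv.Set.sumCompl S, ?_, ?_⟩
  · rintro h (m | m) <;> rfl
  · rintro h (m | m) <;> rfl

variable [Finite G]

/-- A transitive biset is isomorphic to the biset of cosets of a stabilizer. -/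
theorem coset_stab_iso (M : Biset G) (m₀ : M.carrier)
    (hM : ∀ m, ∃ x y : G, m = x • MulOpposite.op y⁻¹ • m₀) : Iso (coset (M.stab m₀)) M := by
  have key : ∀ p q : G × G, p⁻¹ * q ∈ M.stab m₀ ↔
      p.1 • MulOpposite.op p.2⁻¹ • m₀ = q.1 • MulOpposite.op q.2⁻¹ • m₀ := by
    rintro ⟨x, y⟩ ⟨x', y'⟩
    change (x⁻¹ * x', y⁻¹ * y') ∈ _ ↔ x • MulOpposite.op y⁻¹ • m₀ = x' • MulOpposite.op y'⁻¹ • m₀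
    rw [mem_stab, mul_smul, inv_smul_eq_iff, MulOpposite.op_mul, mul_smul, smul_comm x,
      smul_comm x' (MulOpposite.op y'⁻¹), MulOpposite.op_inv y', eq_inv_smul_iff, eq_comm]
  let f : (G × G) ⧸ M.stab m₀ → M.carrier :=
    Quotient.lift (fun p => p.1 • MulOpposite.op p.2⁻¹ • m₀) fun p q h =>
      (key p q).1 (QuotientGroup.leftRel_apply.1 h)
  have hf : Function.Bijective f := by
    constructor
    · rintro ⟨p⟩ ⟨q⟩ h
      exact QuotientGroup.eq.2 ((key p q).2 h)
    · intro m
      obtain ⟨x, y, rfl⟩ := hM m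
      exact ⟨QuotientGroup.mk (x, y), rfl⟩
  refine ⟨Equiv.ofBijective f hf, ?_, ?_⟩
  · rintro h ⟨⟨x, y⟩⟩
    change (h * x) • MulOpposite.op (1 * y)⁻¹ • m₀ = h • x • MulOpposite.op y⁻¹ • m₀
    rw [one_mul, mul_smul]
  · rintro g ⟨⟨x, y⟩⟩
    change (1 * x) • MulOpposite.op (g.unop⁻¹ * y)⁻¹ • m₀ = g • x • MulOpposite.op y⁻¹ • m₀
    rw [one_mul, ← smul_comm x, smul_smul g]
    simp

theorem coset_pairConj_iso (U : Subgroup (G × G)) (g k : G) :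
    Iso (coset (U.pairConj g k)) (coset U) := by
  have h := coset_stab_iso (coset U) (g • MulOpposite.op k⁻¹ • cosetBase U) fun m => by
    obtain ⟨x, y, rfl⟩ := coset_transitive U m
    refine ⟨x * g⁻¹, y * k⁻¹, ?_⟩
    rw [← smul_comm g, smul_smul _ g, smul_smul (MulOpposite.op _)]
    simp
  rwa [stab_smul, stab_cosetBase] at h

end Biset

namespace DoubleBurnside

variable (R : Type) [CommRing R] {G : Type} [Group G] [Finite G]

theorem cls_congr {M N : Biset G} (h : Biset.Iso M N) : cls R M = cls R N := by
  rw [cls, cls, show BisetClass.mk M = BisetClass.mk N from Quotient.sound h]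

theorem cls_sum (M N : Biset G) : cls R (M.sum N) = cls R M + cls R N := by
  rw [cls, cls, cls, ← map_add]
  exact RingQuot.mkAlgHom_rel R (BurnsideRel.sum M N)

/-- Induction on the number of points: one orbit is split off, which is a coset biset, and its
complement is smaller. -/
theorem cls_mem_span_coset (M : Biset G) :
    cls R M ∈ Submodule.span R (Set.range fun U : Subgroup (G × G) => cls R (Biset.coset U)) := by
  induction hn : Nat.card M.carrier using Nat.strong_induction_on generalizing M with
  | _ n ih =>
    subst hn
    cases isEmpty_or_nonempty M.carrier with
    | inl hM =>
      -- The empty biset is its own double, so that its class vanishes.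
      have h : Biset.Iso (M.sum M) M :=
        ⟨Equiv.equivOfIsEmpty (M.carrier ⊕ M.carrier) M.carrier,
          fun _ m => isEmptyElim (α := M.carrier ⊕ M.carrier) m,
          fun _ m => isEmptyElim (α := M.carrier ⊕ M.carrier) m⟩
      have h' := cls_congr R h
      rw [cls_sum, add_eq_left] at h'
      rw [h']
      exact zero_mem _
    | inr hM =>
      obtain ⟨m₀⟩ := hM
      let S : Set M.carrier := {m | ∃ x y : G, m = x • MulOpposite.op y⁻¹ • m₀}
      have hl : ∀ (h : G), ∀ m ∈ S, h • m ∈ S := by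
        rintro h _ ⟨x, y, rfl⟩
        exact ⟨h * x, y, by rw [mul_smul]⟩
      have hr : ∀ (g : Gᵐᵒᵖ), ∀ m ∈ S, g • m ∈ S := by
        rintro g _ ⟨x, y, rfl⟩
        exact ⟨x, g.unop⁻¹ * y, by rw [← smul_comm x, smul_smul g]; simp⟩
      have hl' : ∀ (h : G), ∀ m ∈ Sᶜ, h • m ∈ Sᶜ := fun h m hm hm' =>
        hm (by simpa using hl h⁻¹ _ hm')
      have hr' : ∀ (g : Gᵐᵒᵖ), ∀ m ∈ Sᶜ, g • m ∈ Sᶜ := fun g m hm hm' =>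
        hm (by simpa using hr g⁻¹ _ hm')
      have hm₀ : m₀ ∈ S := ⟨1, 1, by simp⟩
      rw [← cls_congr R (M.iso_sum_restrict S hl hr hl' hr'), cls_sum]
      refine add_mem ?_ (ih _ ?_ _ rfl)
      · rw [← cls_congr R (Biset.coset_stab_iso (M.restrict S hl hr) ⟨m₀, hm₀⟩ ?_)]
        · exact Submodule.subset_span ⟨_, rfl⟩
        · rintro ⟨_, x, y, rfl⟩
          exact ⟨x, y, rfl⟩
      · exact Set.ncard_lt_card (s := Sᶜ) fun h => (h ▸ Set.mem_univ m₀ : m₀ ∈ Sᶜ) hm₀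

theorem span_coset_eq_top :
    Submodule.span R (Set.range fun U : Subgroup (G × G) => cls R (Biset.coset U)) = ⊤ := by
  rw [eq_top_iff]
  rintro x -
  obtain ⟨y, rfl⟩ := RingQuot.mkAlgHom_surjective R (BurnsideRel R G) x
  induction y using MonoidAlgebra.induction_on with
  | of c =>
    obtain ⟨M, rfl⟩ := Quotient.exists_rep c
    exact cls_mem_span_coset R M
  | add x y hx hy =>
    rw [map_add]
    exact add_mem hx hy
  | smul r x hx =>
    rw [map_smul]
    exact Submodule.smul_mem _ r hx

/-- The double Burnside algebra is spanned by the classes `(G × G) / U`, for representatives `U`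
of the conjugacy classes of subgroups. -/
theorem span_range_eq_top {ι : Type} (rep : ι → Subgroup (G × G))
    (hrep : ∀ U, ∃ i g k, U = (rep i).pairConj g k) :
    Submodule.span R (Set.range fun i => cls R (Biset.coset (rep i))) = ⊤ := by
  rw [← span_coset_eq_top R]
  congr 1
  ext x
  constructor
  · rintro ⟨i, rfl⟩
    exact ⟨rep i, rfl⟩
  · rintro ⟨U, rfl⟩
    obtain ⟨i, g, k, rfl⟩ := hrep U
    exact ⟨i, (cls_congr R (Biset.coset_pairConj_iso _ g k)).symm⟩

end DoubleBurnside

end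

noncomputable section

/-! ### Coordinates on `A` -/

namespace PeirceAlg

open Matrix EtaXi

/-- The element of `A` with the given coordinates, in the order `s`, `t`, `u`, `v`, `w`, `x`, `y`,
`z`. -/
def ofVec (v : ℕ → ℚ) : PeirceAlg where
  s := !![v 0, v 1, v 2; v 3, v 4, v 5; v 6, v 7, v 8]
  t := ![v 9, v 10, v 11]
  u := v 12
  v := v 13
  w := v 14
  x := ![v 15, v 16, v 17]
  y := v 18
  z := (v 19, (v 20, v 21))

/-- The coordinates of a product in `A`. -/
def mulCoords {K : Type} [Add K] [Sub K] [Mul K] [OfNat K 12] (u v : ℕ → K) : List K :=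
  [u 0 * v 0 + u 1 * v 3 + u 2 * v 6,
    u 0 * v 1 + u 1 * v 4 + u 2 * v 7,
    u 0 * v 2 + u 1 * v 5 + u 2 * v 8,
    u 3 * v 0 + u 4 * v 3 + u 5 * v 6,
    u 3 * v 1 + u 4 * v 4 + u 5 * v 7,
    u 3 * v 2 + u 4 * v 5 + u 5 * v 8,
    u 6 * v 0 + u 7 * v 3 + u 8 * v 6,
    u 6 * v 1 + u 7 * v 4 + u 8 * v 7,
    u 6 * v 2 + u 7 * v 5 + u 8 * v 8,
    u 0 * v 9 + u 1 * v 10 + u 2 * v 11 + v 19 * u 9,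
    u 3 * v 9 + u 4 * v 10 + u 5 * v 11 + v 19 * u 10,
    u 6 * v 9 + u 7 * v 10 + u 8 * v 11 + v 19 * u 11,
    u 12 * v 12,
    u 12 * v 13 + u 13 * v 19,
    u 14 * v 14,
    u 15 * v 0 + u 16 * v 3 + u 17 * v 6 + u 19 * v 15,
    u 15 * v 1 + u 16 * v 4 + u 17 * v 7 + u 19 * v 16,
    u 15 * v 2 + u 16 * v 5 + u 17 * v 8 + u 19 * v 17,
    u 18 * v 12 + u 19 * v 18,
    u 19 * v 19,
    u 15 * v 9 + u 16 * v 10 + u 17 * v 11 - 12 * (u 18 * v 13) + u 19 * v 20 + v 19 * u 20,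
    u 18 * v 13 + u 19 * v 21 + v 19 * u 21]

theorem ofVec_congr {u v : ℕ → ℚ} (h : ∀ k < 22, u k = v k) : ofVec u = ofVec v := by
  simp only [ofVec]
  rw [h 0, h 1, h 2, h 3, h 4, h 5, h 6, h 7, h 8, h 9, h 10, h 11, h 12, h 13, h 14, h 15, h 16,
    h 17, h 18, h 19, h 20, h 21] <;> norm_num

theorem ofVec_add (u v : ℕ → ℚ) : ofVec u + ofVec v = ofVec (u + v) := by
  refine PeirceAlg.ext ?_ ?_ ?_ ?_ ?_ ?_ ?_ ?_ <;> simp [ofVec]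
  rfl

theorem ofVec_smul (c : ℚ) (v : ℕ → ℚ) : c • ofVec v = ofVec (c • v) := by
  refine PeirceAlg.ext ?_ ?_ ?_ ?_ ?_ ?_ ?_ ?_ <;> simp [ofVec]
  rfl

theorem snd_mul_z_fst (a b : PeirceAlg) : (a * b).z.snd.1 =
    a.x ⬝ᵥ b.t - 12 * (a.y * b.v) + a.z.fst * b.z.snd.1 + b.z.fst * a.z.snd.1 := by
  simp [η, ξ]
  ring

theorem snd_mul_z_snd (a b : PeirceAlg) : (a * b).z.snd.2 =
    a.y * b.v + a.z.fst * b.z.snd.2 + b.z.fst * a.z.snd.2 := by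
  simp [η, ξ]
  ring

theorem ofVec_mul (u v : ℕ → ℚ) :
    ofVec u * ofVec v = ofVec fun k => (mulCoords u v).getD k 0 := by
  refine PeirceAlg.ext ?_ ?_ rfl rfl rfl ?_ rfl ?_
  · ext i j
    fin_cases i <;> fin_cases j <;>
      simp [ofVec, mulCoords, Matrix.mul_apply, Fin.sum_univ_three]
  · ext i
    fin_cases i <;>
    · simp [ofVec, mulCoords, TrivSqZeroExt.fst]
      ring
  · ext i
    fin_cases i <;>
    · simp [ofVec, mulCoords, TrivSqZeroExt.fst]
      ring
  · refine TrivSqZeroExt.ext ?_ (Prod.ext ?_ ?_)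
    · rw [fst_mul_z]
      rfl
    · rw [snd_mul_z_fst, dotProduct, Fin.sum_univ_three]
      rfl
    · rw [snd_mul_z_snd]
      rfl

end PeirceAlg

namespace S₃

/-! ### The elements of `S₃`, numbered by `b ^ r * a ^ s ↦ 2 r + s` -/

/-- The element `b ^ r * a ^ s` of number `2 r + s`. -/
def elt (c : ℕ) : S₃ := b ^ (c / 2) * a ^ (c % 2)

/-- The number of an element of `S₃`. -/
def code (σ : S₃) : ℕ := 2 * (σ 2 + 1).val + if σ 0 = σ 2 + 1 then 0 else 1

/-- The multiplication on numbers. -/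
def mulCode (x y : ℕ) : ℕ :=
  2 * ((x / 2 + (1 + x % 2) * (y / 2)) % 3) + (x + y) % 2

/-- The number of `g⁻¹ * y * g`. -/
def conjCode (g y : ℕ) : ℕ :=
  2 * (((1 + g % 2) * (y / 2 + (y % 2) * (g / 2))) % 3) + y % 2

theorem code_lt (σ : S₃) : code σ < 6 := by
  revert σ
  decide +kernel

/-- As `a` fixes the letter 2, the element b ^ r * a ^ s maps 2 to 2 + r; it maps 0 to r exactly
when s = 0. Hence r and s can be read off from two values. -/
theorem elt_code (σ : S₃) : elt (code σ) = σ := by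
  revert σ
  decide +kernel

theorem code_elt : ∀ c < 6, code (elt c) = c := by
  decide +kernel

/-- Since a b a = b⁻¹, moving a ^ s past b ^ r multiplies r by (-1) ^ s, which is 1 + s modulo 3. In
`conjCode`, conjugating b ^ r * a by b ^ p shifts r by -2 p, which is p modulo 3. -/
theorem code_mul (σ τ : S₃) : code (σ * τ) = mulCode (code σ) (code τ) := by
  revert σ τ
  decide +kernel

theorem code_conj (σ τ : S₃) : code (σ⁻¹ * τ * σ) = conjCode (code σ) (code τ) := by
  revert σ τ
  decide +kernel

theorem code_injective : Function.Injective code := fun σ τ h => by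
  rw [← elt_code σ, h, elt_code]

/-- The sum of the values at the numbers of the elements of `S₃`. -/
def sumCodes {A : Type} [Add A] (f : ℕ → A) : A := f 0 + f 1 + f 2 + f 3 + f 4 + f 5

theorem sumCodes_congr {A : Type} [Add A] {f f' : ℕ → A} (h : ∀ c < 6, f c = f' c) :
    sumCodes f = sumCodes f' := by
  simp only [sumCodes]
  rw [h 0, h 1, h 2, h 3, h 4, h 5] <;> norm_num

theorem sum_eq_sumCodes {A : Type} [AddCommMonoid A] (F : S₃ → A) :
    ∑ σ, F σ = sumCodes fun c => F (elt c) := by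
  have h : ∑ c : Fin 6, F (elt c) = ∑ σ, F σ :=
    Fintype.sum_equiv ⟨fun c : Fin 6 => elt c, fun σ => ⟨code σ, code_lt σ⟩,
      fun c => Fin.ext (code_elt c c.2), elt_code⟩ _ _ fun _ => rfl
  rw [← h, Fin.sum_univ_six]
  rfl

/-! ### Representatives of the conjugacy classes of subgroups of `S₃ × S₃` -/

/-- A bit of a natural number, as a number. -/
def bit (m k : ℕ) : ℕ := (m >>> k) &&& 1

/-- The representatives as sets of bits: the pair of the elements numbered `x` and `y` has
position `6 x + y`. They are `Vᵢ × Vⱼ` in lexicographic order, `Δ(V₁)`, `Δ(V₄)`, `Δ(V₅)`, and the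
subgroups of `H₆`, `H₇`, `H₈`. -/
def mask (i : ℕ) : ℕ :=
  [1, 3, 21, 63, 65, 195, 1365, 4095, 16781313, 50343939, 352407573, 1057222719, 1090785345,
    3272356035, 22906492245, 68719476735, 129, 268451841, 34630287489, 2709, 2164789377,
    45460576917].getD i 0

theorem bit_le (m k : ℕ) : bit m k ≤ 1 := Nat.and_le_right

theorem mask_one : ∀ i < 22, bit (mask i) 0 = 1 := by
  decide +kernel

theorem mask_mul : ∀ i < 22, ∀ p < 36, bit (mask i) p = 1 → ∀ q < 36, bit (mask i) q = 1 →
    bit (mask i) (6 * mulCode (p / 6) (q / 6) + mulCode (p % 6) (q % 6)) = 1 := by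
  decide +kernel

/-- The submonoid underlying `rep`. -/
def repSubmonoid (i : Fin 22) : Submonoid (S₃ × S₃) where
  carrier := {p | bit (mask i) (6 * code p.1 + code p.2) = 1}
  one_mem' := mask_one i i.2
  mul_mem' := by
    rintro p q hp hq
    change bit (mask i) (6 * code (p.1 * q.1) + code (p.2 * q.2)) = 1
    rw [code_mul, code_mul]
    have h1 := code_lt p.1
    have h2 := code_lt p.2
    have h3 := code_lt q.1
    have h4 := code_lt q.2
    have h := mask_mul i i.2 _ (by omega) hp _ (by omega) hq
    rwa [Nat.mul_add_div (by norm_num), Nat.mul_add_div (by norm_num), Nat.mul_add_mod,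
      Nat.mul_add_mod, Nat.div_eq_of_lt h2, Nat.div_eq_of_lt h4, Nat.mod_eq_of_lt h2,
      Nat.mod_eq_of_lt h4] at h

/-- Representatives of the conjugacy classes of subgroups of `S₃ × S₃`. -/
def rep (i : Fin 22) : Subgroup (S₃ × S₃) where
  __ := repSubmonoid i
  inv_mem' := by
    intro p hp
    -- In a finite group inverses are powers, so a submonoid is already a subgroup.
    have h : p⁻¹ = p ^ (Nat.card (S₃ × S₃) - 1) := by
      rw [inv_eq_iff_mul_eq_one, ← pow_succ', Nat.sub_add_cancel Nat.card_pos, pow_card_eq_one']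
    rw [h]
    exact pow_mem (S := repSubmonoid i) hp _

theorem mem_rep {i : Fin 22} {σ τ : S₃} :
    (σ, τ) ∈ rep i ↔ bit (mask i) (6 * code σ + code τ) = 1 := Iff.rfl

theorem ind_rep (i : Fin 22) (σ τ : S₃) :
    (rep i).ind σ τ = bit (mask i) (6 * code σ + code τ) := by
  have h := bit_le (mask i) (6 * code σ + code τ)
  rw [Subgroup.ind]
  split_ifs with hm
  · exact (mem_rep.1 hm).symm
  · rw [mem_rep] at hm
    omega

/-- The conjugacy class of the element numbered `c`. -/
def classCode (c : ℕ) : ℕ := if c % 2 = 1 then 1 else if c = 0 then 0 else 2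

/-- A weight on the pairs of conjugacy classes of `S₃` for which the sums over non-conjugate
subgroups of `S₃ × S₃` differ. -/
def weight (x y : ℕ) : ℕ := [0, 4, 3, 1, 3, 0, 5, 0, 1].getD (3 * classCode x + classCode y) 0

theorem classCode_conj (σ τ : S₃) : classCode (code (σ⁻¹ * τ * σ)) = classCode (code τ) := by
  revert σ τ
  decide +kernel

/-- The sum of the weights of the elements of a subgroup. -/
def totalWeight (U : Subgroup (S₃ × S₃)) : ℕ :=
  ∑ x, ∑ y, U.ind x y * weight (code x) (code y)

/-- The weight of a pair depends only on the conjugacy classes of its two entries. Hence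
`deltaCoset`, which factors through the total weight, is conjugation invariant without choice of a
conjugating element. -/
theorem totalWeight_pairConj (g k : S₃) (U : Subgroup (S₃ × S₃)) :
    totalWeight (U.pairConj g k) = totalWeight U := by
  simp only [totalWeight, Subgroup.ind_pairConj]
  rw [← Subgroup.sum_conj g (fun x => ∑ y, U.ind x y * weight (code x) (code y))]
  refine Finset.sum_congr rfl fun x _ => ?_
  rw [← Subgroup.sum_conj k (fun y => U.ind _ y * weight _ (code y))]
  refine Finset.sum_congr rfl fun y _ => ?_
  simp only [weight, classCode_conj]

/-- The number of the conjugacy class of subgroups with the given total weight. -/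
def classOfWeight (n : ℕ) : ℕ :=
  [0, 4, 6, 18, 1, 8, 7, 28, 10, 14, 20, 32, 13, 26, 23, 62, 3, 2, 11, 15, 19, 47].idxOf n

/-- The coordinates of the images `δ([(S₃ × S₃) / U])` for the representatives `U`. -/
def deltaRow : ℕ → List ℤ
  | 0 => [0, -5, 0, 0, 6, 0, 0, -42, 0, 0, 0, 0, 0, 0, 0, 0, 252, 0, 0, 0, 0, 0]
  | 1 => [15, -60, -10, -18, 72, 12, 126, -504, -84, -10, 12, -84, 0, 0, 0, -756, 3024, 504,
      0, 0, 504, 0]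
  | 2 => [20, -55, -10, -24, 66, 12, 168, -462, -84, -10, 12, -84, 0, 0, 0, -1008, 2772, 504,
      0, 0, 504, 0]
  | 3 => [25, -85, -15, -30, 102, 18, 210, -714, -126, -10, 12, -84, 0, 0, 0, -1260, 4284,
      756, 0, 0, 504, 0]
  | 4 => [0, -2, 0, 0, 3, 0, 0, -20, 0, 0, 0, 0, 0, 0, 0, 0, 120, 0, 0, 0, 0, 0]
  | 5 => [6, -24, -4, -9, 36, 6, 60, -240, -40, -4, 6, -40, 0, 0, 0, -360, 1440, 240, 0, 0,
      240, 0]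
  | 6 => [8, -22, -4, -12, 33, 6, 80, -220, -40, -4, 6, -40, 0, 0, 0, -480, 1320, 240, 0, 0,
      240, 0]
  | 7 => [10, -34, -6, -15, 51, 9, 100, -340, -60, -4, 6, -40, 0, 0, 0, -600, 2040, 360, 0,
      0, 240, 0]
  | 8 => [0, -3, 0, 0, 2, 0, 0, -16, 0, 0, 0, 0, 0, 0, 0, 0, 96, 0, 0, 0, 0, 0]
  | 9 => [9, -36, -6, -6, 24, 4, 48, -192, -32, -6, 4, -32, 0, 0, 0, -288, 1152, 192, 0, 0,
      192, 0]
  | 10 => [12, -33, -6, -8, 22, 4, 64, -176, -32, -6, 4, -32, 0, 0, 0, -384, 1056, 192, 0, 0,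
      192, 0]
  | 11 => [15, -51, -9, -10, 34, 6, 80, -272, -48, -6, 4, -32, 0, 0, 0, -480, 1632, 288, 0, 0,
      192, 0]
  | 12 => [0, -1, 0, 0, 1, 0, 0, -7, 0, 0, 0, 0, 0, 0, 0, 0, 36, 0, 0, 0, 0, 0]
  | 13 => [3, -12, -2, -3, 12, 2, 21, -84, -14, -2, 2, -14, 0, 0, 0, -108, 432, 72, 0, 0, 72, 0]
  | 14 => [4, -11, -2, -4, 11, 2, 28, -77, -14, -2, 2, -14, 0, 0, 0, -144, 396, 72, 0, 0, 72, 0]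
  | 15 => [5, -17, -3, -5, 17, 3, 35, -119, -21, -2, 2, -14, 0, 0, 0, -180, 612, 108, 0, 0, 72, 0]
  | 16 => [-3, 9, 2, 0, 3, 0, -6, 2, 4, 2, 0, 4, 1, 0, 0, 36, -12, -24, 0, 0, -24, 0]
  | 17 => [8, -23, -4, 0, 2, 0, 12, -46, -6, -4, 0, -6, 0, 0, 2, -72, 276, 36, 0, 0, 36, 0]
  | 18 => [1, 0, 0, 0, 1, 0, 0, 0, 1, 0, 0, 0, 1, 0, 1, 0, 0, 0, 0, 1, 0, 0]
  | 19 => [7, -16, -3, -12, 33, 6, 78, -208, -38, -4, 6, -40, 1, -2, 0, -468, 1248, 228, 0, 0,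
      240, 0]
  | 20 => [-3, 10, 2, 0, 1, 0, -6, 15, 4, 2, 0, 4, 1, 0, 0, 72, -228, -48, -2, 0, -48, 0]
  | 21 => [3, -5, -1, -4, 11, 2, 26, -65, -12, -2, 2, -14, 1, -2, 0, -120, 252, 48, -2, 0, 24, 4]
  | _ => []

/-- The coordinate of number `k` of the image of the representative of number `i`. -/
def deltaCoeff (i k : ℕ) : ℤ := (deltaRow i).getD k 0

/-- The image `δ([(S₃ × S₃) / U])` in `A`. -/
def deltaCoset (U : Subgroup (S₃ × S₃)) : PeirceAlg :=
  PeirceAlg.ofVec fun k => deltaCoeff (classOfWeight (totalWeight U)) k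

/-! ### The Mackey formula in coordinates -/

/-- The order of the subgroup with the given bits. -/
def maskSize (m : ℕ) : ℕ := sumCodes fun x => sumCodes fun y => bit m (6 * x + y)

/-- The row of number `x` of the composition of the relation `m` and of the conjugate of the
relation `n` by the element numbered `g`. -/
def compRow (m n g x : ℕ) : ℕ :=
  let f := fun y => bit m (6 * x + y) * ((n >>> (6 * conjCode g y)) &&& 63)
  f 0 ||| f 1 ||| f 2 ||| f 3 ||| f 4 ||| f 5

/-- The total weight of the composition. -/
def compWeight (m n g : ℕ) : ℕ :=
  sumCodes fun x => sumCodes fun z => bit (compRow m n g x) z * weight x z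

/-- The number of triples in the Mackey formula. -/
def compTriples (m n g : ℕ) : ℕ :=
  sumCodes fun y => (sumCodes fun x => bit m (6 * x + y)) *
    sumCodes fun z => bit n (6 * conjCode g y + z)

/-- The Mackey formula for two representatives, in one coordinate. -/
def mackeyCheck (i j k : ℕ) : Bool :=
  (maskSize (mask i) * maskSize (mask j) : ℕ) *
      (PeirceAlg.mulCoords (deltaCoeff i) (deltaCoeff j)).getD k 0 ==
    sumCodes fun g => (compTriples (mask i) (mask j) g : ℤ) *
      deltaCoeff (classOfWeight (compWeight (mask i) (mask j) g)) k

end S₃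

end

/-! ### Reduction to representatives, and the subgroups of S₃ × S₃ -/

noncomputable section

/-- The Mackey formula follows from the Mackey formula for representatives of the conjugacy
classes. -/
theorem Subgroup.mackey_of_rep {G : Type} [Group G] [Fintype G] {A : Type} [Ring A]
    {d : Subgroup (G × G) → A} (hd : ∀ U g k, d (U.pairConj g k) = d U) {ι : Type}
    (rep : ι → Subgroup (G × G)) (hrep : ∀ U, ∃ i g k, U = (rep i).pairConj g k)
    (h : ∀ i j, ((rep i).size * (rep j).size) • (d (rep i) * d (rep j)) =
      ∑ g : G, (rep i).triples ((rep j).pairConj g 1) • d ((rep i).relComp ((rep j).pairConj g 1)))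
    (U V : Subgroup (G × G)) : (U.size * V.size) • (d U * d V) =
      ∑ g : G, U.triples (V.pairConj g 1) • d (U.relComp (V.pairConj g 1)) := by
  obtain ⟨i, p, q, rfl⟩ := hrep U
  obtain ⟨j, r, s, rfl⟩ := hrep V
  rw [size_pairConj, size_pairConj, hd, hd, h]
  -- The substitution g ↦ q g r⁻¹ cancels the conjugation by r and the one by q transferred from the
  -- first subgroup; the outer conjugations by p and s do not affect `d` or the number of triples.
  refine Fintype.sum_equiv ((Equiv.mulLeft q).trans (Equiv.mulRight r⁻¹)) _ _ fun g => ?_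
  have hj : ((rep j).pairConj r s).pairConj (q * g * r⁻¹) 1 =
      ((rep j).pairConj (q * g) 1).pairConj 1 s := by
    simp [pairConj_pairConj]
  have hq : ((rep j).pairConj (q * g) 1).pairConj q⁻¹ 1 = (rep j).pairConj g 1 := by
    simp [pairConj_pairConj]
  simp only [Equiv.trans_apply, Equiv.coe_mulLeft, Equiv.coe_mulRight]
  rw [hj, triples_pairConj_right, relComp_pairConj_right, triples_pairConj_left,
    relComp_pairConj_left, hd, hd, hq]

namespace S₃

open Equiv.Perm

/-! ### Classification of the subgroups of `S₃ × S₃` -/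

/-- The power of `a` of the same sign. -/
def red (σ : S₃) : S₃ := elt (code σ % 2)

theorem exists_conj_eq (σ : S₃) (h : sign σ = -1) : ∃ g : S₃, g⁻¹ * a * g = σ := by
  revert σ
  decide +kernel

theorem red_of_sign_one (σ : S₃) (h : sign σ = 1) : red σ = 1 := by
  revert σ
  decide +kernel

theorem red_of_sign_neg_one (σ : S₃) (h : sign σ = -1) : red σ = a := by
  revert σ
  decide +kernel

theorem pow_three_of_sign_one (σ : S₃) (h : sign σ = 1) : σ ^ 3 = 1 := by
  revert σ
  decide +kernel

theorem pow_three_of_sign_neg_one (σ : S₃) (h : sign σ = -1) : σ ^ 3 = σ := by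
  revert σ
  decide +kernel

/-- Every subgroup of `S₃ × S₃` is conjugate to a subgroup that contains, with an element, its
component in `⟨a⟩ × ⟨a⟩`. -/
theorem exists_pairConj_red_mem (U : Subgroup (S₃ × S₃)) :
    ∃ g k, ∀ σ τ, (σ, τ) ∈ U.pairConj g k → (red σ, red τ) ∈ U.pairConj g k := by
  have hsign : ∀ g σ : S₃, sign (g⁻¹ * σ * g) = sign σ := fun g σ => by
    rw [Equiv.Perm.sign_mul, Equiv.Perm.sign_mul, sign_inv, mul_comm, ← mul_assoc, Int.units_mul_self, one_mul]
  -- Cubing trivializes even permutations and fixes odd ones.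
  have h10 : ∀ σ τ, (σ, τ) ∈ U → sign σ = -1 → sign τ = 1 → (σ, 1) ∈ U := fun σ τ h hσ hτ => by
    have := U.pow_mem h 3
    rwa [Prod.pow_mk, pow_three_of_sign_one τ hτ, pow_three_of_sign_neg_one σ hσ] at this
  have h01 : ∀ σ τ, (σ, τ) ∈ U → sign σ = 1 → sign τ = -1 → (1, τ) ∈ U := fun σ τ h hσ hτ => by
    have := U.pow_mem h 3
    rwa [Prod.pow_mk, pow_three_of_sign_one σ hσ, pow_three_of_sign_neg_one τ hτ] at this
  -- It suffices to conjugate, for each occurring pattern of signs other than (even, even), one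
  -- element to its component in ⟨a⟩ × ⟨a⟩.
  have key : ∀ g k,
      ((∃ σ, sign σ = -1 ∧ (σ, 1) ∈ U) → (a, 1) ∈ U.pairConj g k) →
      ((∃ τ, sign τ = -1 ∧ (1, τ) ∈ U) → (1, a) ∈ U.pairConj g k) →
      ((∃ σ τ, sign σ = -1 ∧ sign τ = -1 ∧ (σ, τ) ∈ U) → (a, a) ∈ U.pairConj g k) →
      ∀ σ τ, (σ, τ) ∈ U.pairConj g k → (red σ, red τ) ∈ U.pairConj g k := by
    intro g k h1 h2 h3 σ τ h
    rcases Int.units_eq_one_or (sign σ) with hσ | hσ <;>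
      rcases Int.units_eq_one_or (sign τ) with hτ | hτ
    · rw [red_of_sign_one σ hσ, red_of_sign_one τ hτ]
      exact one_mem _
    · rw [red_of_sign_one σ hσ, red_of_sign_neg_one τ hτ]
      exact h2 ⟨_, (hsign k τ).trans hτ, h01 _ _ h ((hsign g σ).trans hσ) ((hsign k τ).trans hτ)⟩
    · rw [red_of_sign_neg_one σ hσ, red_of_sign_one τ hτ]
      exact h1 ⟨_, (hsign g σ).trans hσ, h10 _ _ h ((hsign g σ).trans hσ) ((hsign k τ).trans hτ)⟩
    · rw [red_of_sign_neg_one σ hσ, red_of_sign_neg_one τ hτ]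
      exact h3 ⟨_, _, (hsign g σ).trans hσ, (hsign k τ).trans hτ, h⟩
  have hmul : ∀ g k, (a, 1) ∈ U.pairConj g k → (1, a) ∈ U.pairConj g k →
      (a, a) ∈ U.pairConj g k := fun g k h h' => by simpa using mul_mem h h'
  by_cases h1 : ∃ σ, sign σ = -1 ∧ (σ, 1) ∈ U <;>
    by_cases h2 : ∃ τ, sign τ = -1 ∧ (1, τ) ∈ U
  · obtain ⟨σ, hσ, hσU⟩ := h1
    obtain ⟨τ, hτ, hτU⟩ := h2
    obtain ⟨g, rfl⟩ := exists_conj_eq σ hσ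
    obtain ⟨k, rfl⟩ := exists_conj_eq τ hτ
    have ha : (a, 1) ∈ U.pairConj g k := by simpa [Subgroup.mem_pairConj] using hσU
    have hb : (1, a) ∈ U.pairConj g k := by simpa [Subgroup.mem_pairConj] using hτU
    exact ⟨g, k, key g k (fun _ => ha) (fun _ => hb) fun _ => hmul g k ha hb⟩
  · obtain ⟨σ, hσ, hσU⟩ := h1
    obtain ⟨g, rfl⟩ := exists_conj_eq σ hσ
    have ha : (a, 1) ∈ U.pairConj g 1 := by simpa [Subgroup.mem_pairConj] using hσU
    refine ⟨g, 1, key g 1 (fun _ => ha) (fun h => absurd h h2) ?_⟩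
    -- An (odd, odd) element times the given (odd, 1) is (even, odd), and its cube would be an
    -- element (1, odd), against `h2`.
    rintro ⟨σ', τ', hσ', hτ', h⟩
    refine absurd ⟨τ', hτ', h01 (σ' * (g⁻¹ * a * g)) τ' ?_ ?_ hτ'⟩ h2
    · simpa using mul_mem h hσU
    · rw [Equiv.Perm.sign_mul, hσ', hσ]
      rfl
  · obtain ⟨τ, hτ, hτU⟩ := h2
    obtain ⟨k, rfl⟩ := exists_conj_eq τ hτ
    have hb : (1, a) ∈ U.pairConj 1 k := by simpa [Subgroup.mem_pairConj] using hτU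
    refine ⟨1, k, key 1 k (fun h => absurd h h1) (fun _ => hb) ?_⟩
    rintro ⟨σ', τ', hσ', hτ', h⟩
    refine absurd ⟨σ', hσ', h10 σ' (τ' * (k⁻¹ * a * k)) ?_ hσ' ?_⟩ h1
    · simpa using mul_mem h hτU
    · rw [Equiv.Perm.sign_mul, hτ', hτ]
      rfl
  · by_cases h3 : ∃ σ τ, sign σ = -1 ∧ sign τ = -1 ∧ (σ, τ) ∈ U
    · obtain ⟨σ, τ, hσ, hτ, h⟩ := h3
      obtain ⟨g, rfl⟩ := exists_conj_eq σ hσ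
      obtain ⟨k, rfl⟩ := exists_conj_eq τ hτ
      exact ⟨g, k, key g k (fun h => absurd h h1) (fun h => absurd h h2) fun _ => h⟩
    · exact ⟨1, 1, key 1 1 (fun h => absurd h h1) (fun h => absurd h h2) (fun h => absurd h h3)⟩

/-- The subset of `S₃ × S₃` that consists of the products of elements of a union of cyclic
subgroups of `⟨b⟩ × ⟨b⟩`, as given by `n₁, …, n₄`, and of a subset of `⟨a⟩ × ⟨a⟩` that contains the
neutral element, as given by `e₁, e₂, e₃`. -/
def splitSet (n₁ n₂ n₃ n₄ e₁ e₂ e₃ : Bool) (x y : ℕ) : Bool :=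
  (if x % 2 = 0 then y % 2 = 0 || e₂ else if y % 2 = 0 then e₁ else e₃) &&
  (if x / 2 = 0 then y / 2 = 0 || n₂ else if y / 2 = 0 then n₁ else
    if x / 2 = y / 2 then n₃ else n₄)

/-- Of the 128 patterns, those closed under products of the eight test elements are, by evaluation,
representatives up to conjugation. Conjugation of the second factor by `a` (the value `k = 1`)
inverts `b` there, and so turns the subgroup generated by (b, b²) into the one generated by (b, b).
-/
theorem splitSet_eq_mask : ∀ n₁ n₂ n₃ n₄ e₁ e₂ e₃ : Bool,
    (∀ p ∈ [(2, 0), (4, 0), (0, 2), (2, 2), (2, 4), (1, 0), (0, 1), (1, 1)],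
      splitSet n₁ n₂ n₃ n₄ e₁ e₂ e₃ p.1 p.2 = true →
      ∀ q ∈ [(2, 0), (4, 0), (0, 2), (2, 2), (2, 4), (1, 0), (0, 1), (1, 1)],
      splitSet n₁ n₂ n₃ n₄ e₁ e₂ e₃ q.1 q.2 = true →
      splitSet n₁ n₂ n₃ n₄ e₁ e₂ e₃ (mulCode p.1 q.1) (mulCode p.2 q.2) = true) →
    ∃ i : Fin 22, ∃ k ∈ [0, 1], ∀ x < 6, ∀ y < 6,
      splitSet n₁ n₂ n₃ n₄ e₁ e₂ e₃ x y = true ↔ bit (mask i) (6 * x + conjCode k y) = 1 := by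
  decide +kernel

/-- Under the hypothesis, W is the product of its intersections with ⟨b⟩ × ⟨b⟩ and ⟨a⟩ × ⟨a⟩, so
each of the two can be studied separately. -/
theorem mem_iff_of_red {W : Subgroup (S₃ × S₃)}
    (hW : ∀ σ τ, (σ, τ) ∈ W → (red σ, red τ) ∈ W) (x y : ℕ) (hx : x < 6) (hy : y < 6) :
    (elt x, elt y) ∈ W ↔
      (elt (x % 2), elt (y % 2)) ∈ W ∧ (b ^ (x / 2), b ^ (y / 2)) ∈ W := by
  have h : ((b ^ (x / 2), b ^ (y / 2)) : S₃ × S₃) * (elt (x % 2), elt (y % 2)) =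
      (elt x, elt y) := by
    simp [elt, Nat.div_eq_of_lt (Nat.mod_lt _ two_pos)]
  constructor
  · intro hm
    have hr := hW _ _ hm
    rw [red, red, code_elt x hx, code_elt y hy] at hr
    refine ⟨hr, ?_⟩
    rwa [← h, Subgroup.mul_mem_cancel_right _ hr] at hm
  · rintro ⟨hr, hn⟩
    rw [← h]
    exact mul_mem hn hr

-- Seven memberships determine W: the subgroups of order 3 of ⟨b⟩ × ⟨b⟩ are generated by (b, 1), (1,
-- b), (b, b) and (b, b²), and a generator lies in W if and only if its inverse, which is its
-- square, does.
open scoped Classical in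
theorem mem_iff_splitSet {W : Subgroup (S₃ × S₃)}
    (hW : ∀ σ τ, (σ, τ) ∈ W → (red σ, red τ) ∈ W) (x y : ℕ) (hx : x < 6) (hy : y < 6) :
    (elt x, elt y) ∈ W ↔ splitSet (decide ((b, 1) ∈ W)) (decide ((1, b) ∈ W))
      (decide ((b, b) ∈ W)) (decide ((b, b ^ 2) ∈ W)) (decide ((a, 1) ∈ W))
      (decide ((1, a) ∈ W)) (decide ((a, a) ∈ W)) x y = true := by
  have hb : b ^ 3 = 1 := by decide +kernel
  have hsq : ∀ σ τ : S₃, σ ^ 3 = 1 → τ ^ 3 = 1 → ((σ ^ 2, τ ^ 2) ∈ W ↔ (σ, τ) ∈ W) := by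
    intro σ τ hσ hτ
    have h : ((σ ^ 2, τ ^ 2) : S₃ × S₃) = (σ, τ)⁻¹ := by
      rw [eq_inv_iff_mul_eq_one, Prod.mk_mul_mk, ← pow_succ, ← pow_succ, hσ, hτ]
      rfl
    rw [h, inv_mem_iff]
  have hb4 : (b ^ 2) ^ 2 = b := by decide +kernel
  have h1 : (elt (x % 2), elt (y % 2)) ∈ W ↔ (if x % 2 = 0 then
      decide (y % 2 = 0) || decide ((1, a) ∈ W) else if y % 2 = 0 then decide ((a, 1) ∈ W) else
      decide ((a, a) ∈ W)) = true := by
    have hx2 := Nat.mod_lt x two_pos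
    have hy2 := Nat.mod_lt y two_pos
    generalize x % 2 = s at *
    generalize y % 2 = t at *
    interval_cases s <;> interval_cases t <;> simp [elt, ← Prod.one_eq_mk, one_mem]
  have h2 : (b ^ (x / 2), b ^ (y / 2)) ∈ W ↔ (if x / 2 = 0 then
      decide (y / 2 = 0) || decide ((1, b) ∈ W) else if y / 2 = 0 then decide ((b, 1) ∈ W) else
      if x / 2 = y / 2 then decide ((b, b) ∈ W) else decide ((b, b ^ 2) ∈ W)) = true := by
    have hx2 : x / 2 < 3 := by omega
    have hy2 : y / 2 < 3 := by omega
    have q1 := hsq b 1 hb (one_pow 3)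
    have q2 := hsq 1 b (one_pow 3) hb
    have q3 := hsq b b hb hb
    have q4 := hsq b (b ^ 2) hb (by rw [← pow_mul, mul_comm, pow_mul, hb, one_pow])
    rw [one_pow] at q1 q2
    rw [hb4] at q4
    generalize x / 2 = s at *
    generalize y / 2 = t at *
    interval_cases s <;> interval_cases t <;>
      simp [← Prod.one_eq_mk, one_mem, q1, q2, q3, q4]
  rw [mem_iff_of_red hW x y hx hy, h1, h2, splitSet, Bool.and_eq_true]

theorem mulCode_lt (x y : ℕ) : mulCode x y < 6 := by
  unfold mulCode
  omega

theorem elt_mul (x y : ℕ) (hx : x < 6) (hy : y < 6) : elt x * elt y = elt (mulCode x y) := by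
  rw [← elt_code (elt x * elt y), code_mul, code_elt x hx, code_elt y hy]

/-- Every subgroup of `S₃ × S₃` is conjugate to one of the representatives. -/
theorem exists_eq_pairConj_rep (U : Subgroup (S₃ × S₃)) : ∃ i g k, U = (rep i).pairConj g k := by
  obtain ⟨g, k, hW⟩ := exists_pairConj_red_mem U
  set W := U.pairConj g k with hWdef
  have hmem := mem_iff_splitSet hW
  obtain ⟨i, l, hl, h⟩ := splitSet_eq_mask _ _ _ _ _ _ _ (fun p hp hpW q hq hqW => by
    have hlt : ∀ r ∈ [(2, 0), (4, 0), (0, 2), (2, 2), (2, 4), (1, 0), (0, 1), (1, 1)],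
        r.1 < 6 ∧ r.2 < 6 := by decide
    obtain ⟨hp1, hp2⟩ := hlt p hp
    obtain ⟨hq1, hq2⟩ := hlt q hq
    rw [← hmem _ _ hp1 hp2] at hpW
    rw [← hmem _ _ hq1 hq2] at hqW
    have := mul_mem hpW hqW
    rwa [Prod.mk_mul_mk, elt_mul _ _ hp1 hq1, elt_mul _ _ hp2 hq2,
      hmem _ _ (mulCode_lt _ _) (mulCode_lt _ _)] at this)
  replace hl : l < 6 := by
    simp only [List.mem_cons, List.not_mem_nil, or_false] at hl
    omega
  refine ⟨i, g⁻¹, k⁻¹ * elt l, ?_⟩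
  have hWi : W = (rep i).pairConj 1 (elt l) := by
    ext ⟨σ, τ⟩
    have := (hmem (code σ) (code τ) (code_lt _) (code_lt _)).trans
      (h (code σ) (code_lt _) (code τ) (code_lt _))
    rw [elt_code, elt_code] at this
    rw [this, Subgroup.mem_pairConj, mem_rep, code_conj (elt l), code_elt l hl]
    simp
  have hUW : U = W.pairConj g⁻¹ k⁻¹ := by
    rw [hWdef, Subgroup.pairConj_pairConj, inv_mul_cancel, inv_mul_cancel, Subgroup.pairConj_one]
  rw [hUW, hWi, Subgroup.pairConj_pairConj, mul_one]

end S₃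

end

/-! ### Verification of the Mackey formula for the representatives -/

noncomputable section

namespace S₃

open PeirceAlg

theorem sumCodes_apply {A B : Type} [AddCommMonoid A] [AddCommMonoid B] (φ : A →+ B)
    (f : ℕ → A) : φ (sumCodes f) = sumCodes fun c => φ (f c) := by
  simp [sumCodes]

theorem size_rep (i : Fin 22) : (rep i).size = maskSize (mask i) := by
  rw [Subgroup.size, sum_eq_sumCodes]
  refine sumCodes_congr fun x hx => ?_
  rw [sum_eq_sumCodes]
  refine sumCodes_congr fun y hy => ?_
  rw [ind_rep, code_elt x hx, code_elt y hy]

theorem ind_rep_pairConj (j : Fin 22) {g y z : ℕ} (hg : g < 6) (hy : y < 6) (hz : z < 6) :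
    ((rep j).pairConj (elt g) 1).ind (elt y) (elt z) = bit (mask j) (6 * conjCode g y + z) := by
  rw [Subgroup.ind_pairConj, ind_rep, code_conj, code_elt g hg, code_elt y hy]
  simp [code_elt z hz]

theorem triples_rep (i j : Fin 22) {g : ℕ} (hg : g < 6) :
    (rep i).triples ((rep j).pairConj (elt g) 1) = compTriples (mask i) (mask j) g := by
  rw [Subgroup.triples, sum_eq_sumCodes]
  refine sumCodes_congr fun y hy => ?_
  rw [sum_eq_sumCodes, sum_eq_sumCodes]
  congr 1
  · refine sumCodes_congr fun x hx => ?_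
    rw [ind_rep, code_elt x hx, code_elt y hy]
  · exact sumCodes_congr fun z hz => ind_rep_pairConj j hg hy hz

theorem bit_eq_toNat (m k : ℕ) : bit m k = (m.testBit k).toNat := by
  rw [bit, Nat.toNat_testBit, Nat.and_one_is_mod, Nat.shiftRight_eq_div_pow]

theorem bit_row {n c z : ℕ} (hz : z < 6) : bit ((n >>> (6 * c)) &&& 63) z = bit n (6 * c + z) := by
  have h : (63 : ℕ).testBit z = true := by interval_cases z <;> decide
  rw [bit_eq_toNat, bit_eq_toNat, Nat.testBit_and, h, Bool.and_true, Nat.testBit_shiftRight]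

theorem bit_or (m n k : ℕ) : bit (m ||| n) k = max (bit m k) (bit n k) := by
  simp only [bit_eq_toNat, Nat.testBit_or]
  cases m.testBit k <;> cases n.testBit k <;> rfl

theorem bit_mul_bit (m n k l : ℕ) : bit (bit m k * n) l = bit m k * bit n l := by
  rw [bit_eq_toNat m k]
  cases m.testBit k
  · simp [bit]
  · simp

theorem exists_code {P : S₃ → Prop} :
    (∃ σ, P σ) ↔ P (elt 0) ∨ P (elt 1) ∨ P (elt 2) ∨ P (elt 3) ∨ P (elt 4) ∨ P (elt 5) := by
  constructor
  · rintro ⟨σ, h⟩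
    have hc := code_lt σ
    rw [← elt_code σ] at h
    generalize code σ = c at *
    interval_cases c <;> simp [h]
  · rintro (h | h | h | h | h | h) <;> exact ⟨_, h⟩

-- Row x of the composition is the union of the rows y of the second relation over all y related to
-- x by the first; on bit sets the union is a bitwise or.
open scoped Classical in
theorem ind_relComp_rep (i j : Fin 22) {g x z : ℕ} (hg : g < 6) (hx : x < 6) (hz : z < 6) :
    ((rep i).relComp ((rep j).pairConj (elt g) 1)).ind (elt x) (elt z) =
      bit (compRow (mask i) (mask j) g x) z := by
  have hf : ∀ y < 6, bit (bit (mask i) (6 * x + y) *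
      (((mask j) >>> (6 * conjCode g y)) &&& 63)) z =
      if (elt x, elt y) ∈ rep i ∧ (elt y, elt z) ∈ (rep j).pairConj (elt g) 1 then 1 else 0 := by
    intro y hy
    have h1 := ind_rep i (elt x) (elt y)
    have h2 := ind_rep_pairConj j hg hy hz
    rw [code_elt x hx, code_elt y hy] at h1
    rw [bit_mul_bit, bit_row hz, ← h1, ← h2, Subgroup.ind, Subgroup.ind, ite_zero_mul_ite_zero,
      one_mul]
  simp only [compRow, bit_or]
  rw [hf 0, hf 1, hf 2, hf 3, hf 4, hf 5, Subgroup.ind, Subgroup.mem_relComp, exists_code] <;>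
    try norm_num
  split_ifs <;> simp_all

theorem totalWeight_relComp_rep (i j : Fin 22) {g : ℕ} (hg : g < 6) :
    totalWeight ((rep i).relComp ((rep j).pairConj (elt g) 1)) =
      compWeight (mask i) (mask j) g := by
  rw [totalWeight, sum_eq_sumCodes]
  refine sumCodes_congr fun x hx => ?_
  rw [sum_eq_sumCodes]
  refine sumCodes_congr fun z hz => ?_
  rw [ind_relComp_rep i j hg hx hz, code_elt x hx, code_elt z hz]

theorem totalWeight_rep (i : Fin 22) : totalWeight (rep i) =
    sumCodes fun x => sumCodes fun y => bit (mask i) (6 * x + y) * weight x y := by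
  rw [totalWeight, sum_eq_sumCodes]
  refine sumCodes_congr fun x hx => ?_
  rw [sum_eq_sumCodes]
  refine sumCodes_congr fun y hy => ?_
  rw [ind_rep, code_elt x hx, code_elt y hy]

/-- The 22 total weights are distinct. With the classification, the total weight is thus a complete
invariant of conjugacy. -/
theorem classOfWeight_mask : ∀ i < 22, (classOfWeight (sumCodes fun x => sumCodes fun y =>
    bit (mask i) (6 * x + y) * weight x y)) = i := by
  decide +kernel

theorem deltaCoset_rep (i : Fin 22) : deltaCoset (rep i) = ofVec fun k => deltaCoeff i k := by
  rw [deltaCoset, totalWeight_rep, classOfWeight_mask i i.2]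

/-- The computational core: the table is integral and subgroups are bit sets, so all 22³ coordinate
identities are evaluated in integer arithmetic. -/
theorem mackeyCheck_eq_true : ∀ i < 22, ∀ j < 22, ∀ k < 22, mackeyCheck i j k = true := by
  decide +kernel

theorem mulCoords_intCast (u v : ℕ → ℤ) (k : ℕ) :
    (mulCoords (fun k => (u k : ℚ)) fun k => (v k : ℚ)).getD k 0 =
      ((mulCoords u v).getD k 0 : ℤ) := by
  have h : mulCoords (fun k => (u k : ℚ)) (fun k => (v k : ℚ)) =
      (mulCoords u v).map (Int.cast : ℤ → ℚ) := by
    simp [mulCoords]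
  rw [h, ← Int.cast_zero, List.getD_map]

/-- `ofVec` as a linear map. -/
def ofVecLinear : (ℕ → ℚ) →ₗ[ℚ] PeirceAlg where
  toFun := ofVec
  map_add' u v := (ofVec_add u v).symm
  map_smul' c v := (ofVec_smul c v).symm

theorem ofVecLinear_apply (v : ℕ → ℚ) : ofVecLinear v = ofVec v := rfl

theorem mackey_rep (i j : Fin 22) :
    ((rep i).size * (rep j).size) • (deltaCoset (rep i) * deltaCoset (rep j)) =
      ∑ g : S₃, (rep i).triples ((rep j).pairConj g 1) •
        deltaCoset ((rep i).relComp ((rep j).pairConj g 1)) := by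
  have hr : ∑ g : S₃, (rep i).triples ((rep j).pairConj g 1) •
        deltaCoset ((rep i).relComp ((rep j).pairConj g 1)) =
      ofVecLinear (sumCodes fun g => compTriples (mask i) (mask j) g •
        fun k => (deltaCoeff (classOfWeight (compWeight (mask i) (mask j) g)) k : ℚ)) := by
    rw [sum_eq_sumCodes, ← LinearMap.toAddMonoidHom_coe, sumCodes_apply]
    refine sumCodes_congr fun g hg => ?_
    rw [triples_rep i j hg, deltaCoset, totalWeight_relComp_rep i j hg, map_nsmul]
    rfl
  rw [hr, deltaCoset_rep, deltaCoset_rep, ofVec_mul, size_rep, size_rep]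
  rw [← ofVecLinear_apply, ← map_nsmul, ofVecLinear_apply, ofVecLinear_apply]
  refine ofVec_congr fun k hk => ?_
  have h := mackeyCheck_eq_true i i.2 j j.2 k hk
  rw [mackeyCheck, beq_iff_eq] at h
  replace h := congrArg (Int.cast : ℤ → ℚ) h
  simp only [Pi.smul_apply, mulCoords_intCast, sumCodes, Pi.add_apply, nsmul_eq_mul]
  simpa [sumCodes] using h

theorem isMackey_deltaCoset : IsMackey deltaCoset where
  conj U g k := by rw [deltaCoset, totalWeight_pairConj, deltaCoset]
  mackey := Subgroup.mackey_of_rep (fun U g k => by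
    rw [deltaCoset, totalWeight_pairConj, deltaCoset]) rep exists_eq_pairConj_rep mackey_rep
  diag U hU := by
    -- Number 18 is the diagonal subgroup Δ(S₃), and row 18 of the table is the identity of A.
    have hmask : ∀ x < 6, ∀ y < 6, x = y ↔ bit (mask 18) (6 * x + y) = 1 := by decide +kernel
    have h : U = rep 18 := by
      ext ⟨σ, τ⟩
      rw [hU, mem_rep, ← code_injective.eq_iff]
      exact hmask _ (code_lt σ) _ (code_lt τ)
    rw [h, deltaCoset_rep]
    refine PeirceAlg.ext ?_ ?_ ?_ ?_ ?_ ?_ ?_ ?_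
    · ext i j
      fin_cases i <;> fin_cases j <;> simp [ofVec, deltaCoeff, deltaRow]
    · ext i
      fin_cases i <;> simp [ofVec, deltaCoeff, deltaRow]
    · simp [ofVec, deltaCoeff, deltaRow]
    · simp [ofVec, deltaCoeff, deltaRow]
    · simp [ofVec, deltaCoeff, deltaRow]
    · ext i
      fin_cases i <;> simp [ofVec, deltaCoeff, deltaRow]
    · simp [ofVec, deltaCoeff, deltaRow]
    · refine TrivSqZeroExt.ext ?_ (Prod.ext ?_ ?_)
      · change ((deltaCoeff 18 19 : ℤ) : ℚ) = 1
        simp [deltaCoeff, deltaRow]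
      · change ((deltaCoeff 18 20 : ℤ) : ℚ) = 0
        simp [deltaCoeff, deltaRow]
      · change ((deltaCoeff 18 21 : ℤ) : ℚ) = 0
        simp [deltaCoeff, deltaRow]

end S₃

end

noncomputable section

namespace S₃

open PeirceAlg

/-! ### The images of the representatives as a basis of `A` -/

/-- The coordinates of an element of `A`. -/
def _root_.PeirceAlg.coord (a : PeirceAlg) (k : ℕ) : ℚ :=
  [a.s 0 0, a.s 0 1, a.s 0 2, a.s 1 0, a.s 1 1, a.s 1 2, a.s 2 0, a.s 2 1, a.s 2 2,
    a.t 0, a.t 1, a.t 2, a.u, a.v, a.w, a.x 0, a.x 1, a.x 2, a.y, a.z.fst, a.z.snd.1,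
    a.z.snd.2].getD k 0

theorem _root_.PeirceAlg.ofVec_coord (a : PeirceAlg) : ofVec a.coord = a := by
  refine PeirceAlg.ext ?_ ?_ rfl rfl rfl ?_ rfl rfl
  · ext i j
    fin_cases i <;> fin_cases j <;> rfl
  · ext i
    fin_cases i <;> rfl
  · ext i
    fin_cases i <;> rfl

theorem _root_.PeirceAlg.coord_ofVec (v : ℕ → ℚ) {k : ℕ} (hk : k < 22) :
    (ofVec v).coord k = v k := by
  interval_cases k <;> rfl

/-- Up to the factor `24`, the coefficients of the standard basis of `A` in terms of the images of
the representatives. -/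
def basisRow : ℕ → List ℤ
  | 0 => [-96, 96, -96, 0, 144, -144, 144, 0, 72, -72, 72, 0, 0, 0, 0, 0, 0, 0, 0, 0, 0, 0]
  | 1 => [96, 0, 0, 0, -144, 0, 0, 0, -72, 0, 0, 0, 0, 0, 0, 0, 0, 0, 0, 0, 0, 0]
  | 2 => [-672, 96, -192, 96, 1008, -144, 288, -144, 504, -72, 144, -72, 0, 0, 0, 0, 0, 0, 0,
      0, 0, 0]
  | 3 => [336, -336, 336, 0, -552, 552, -552, 0, -192, 192, -192, 0, 0, 0, 0, 0, 0, 0, 0, 0,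
      0, 0]
  | 4 => [-336, 0, 0, 0, 552, 0, 0, 0, 192, 0, 0, 0, 0, 0, 0, 0, 0, 0, 0, 0, 0, 0]
  | 5 => [2352, -336, 672, -336, -3864, 552, -1104, 552, -1344, 192, -384, 192, 0, 0, 0, 0,
      0, 0, 0, 0, 0, 0]
  | 6 => [72, -72, 72, 0, -120, 120, -120, 0, -48, 48, -48, 0, 24, -24, 24, 0, 0, 0, 0, 0, 0, 0]
  | 7 => [-72, 0, 0, 0, 120, 0, 0, 0, 48, 0, 0, 0, -24, 0, 0, 0, 0, 0, 0, 0, 0, 0]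
  | 8 => [504, -72, 144, -72, -840, 120, -240, 120, -336, 48, -96, 48, 168, -24, 48, -24, 0,
      0, 0, 0, 0, 0]
  | 9 => [-48, 96, 48, -96, 72, -144, -72, 144, 36, -72, -36, 72, 0, 0, 0, 0, 0, 0, 0, 0, 0, 0]
  | 10 => [168, -336, -168, 336, -276, 552, 276, -552, -96, 192, 96, -192, 0, 0, 0, 0, 0, 0,
      0, 0, 0, 0]
  | 11 => [36, -72, -36, 72, -60, 120, 60, -120, -24, 48, 24, -48, 12, -24, -12, 24, 0, 0, 0,
      0, 0, 0]
  | 12 => [-24, 24, 0, 0, 24, -48, 0, 0, 0, 0, 0, 0, 0, 0, 0, 0, 24, 0, 0, 0, 0, 0]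
  | 13 => [-12, 12, 12, -12, 12, -24, -12, 24, 0, 0, 0, 0, 0, 0, 0, 0, 12, 0, 0, -12, 0, 0]
  | 14 => [-6, 0, 6, 0, 0, 0, 0, 0, 6, 0, -18, 0, 0, 0, 0, 0, 0, 12, 0, 0, 0, 0]
  | 15 => [2, -2, 2, 0, -4, 4, -4, 0, -2, 2, -2, 0, 4, -4, 4, 0, 0, 0, 0, 0, 0, 0]
  | 16 => [-2, 0, 0, 0, 4, 0, 0, 0, 2, 0, 0, 0, -4, 0, 0, 0, 0, 0, 0, 0, 0, 0]
  | 17 => [14, -2, 4, -2, -28, 4, -8, 4, -14, 2, -4, 2, 28, -4, 8, -4, 0, 0, 0, 0, 0, 0]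
  | 18 => [-12, 12, 0, 0, 12, -24, 0, 0, 12, -12, 0, 0, -12, 24, 0, 0, 12, 0, 0, 0, -12, 0]
  | 19 => [-42, -48, -54, 72, 120, 72, 96, -120, 66, 24, 42, -48, -168, 24, -48, 24, -24, -12,
      24, 0, 0, 0]
  | 20 => [1, -2, -1, 2, -2, 4, 2, -4, -1, 2, 1, -2, 2, -4, -2, 4, 0, 0, 0, 0, 0, 0]
  | 21 => [6, -18, -6, 18, -18, 36, 18, -36, -6, 18, 6, -18, 18, -36, -18, 36, 6, 0, 0, -6, -6, 6]
  | _ => []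

/-- The coefficient of number `i` of `24` times the element of number `k` of the standard basis. -/
def basisCoeff (k i : ℕ) : ℤ := (basisRow k).getD i 0

theorem sum_deltaCoeff_mul_basisCoeff : ∀ i j : Fin 22,
    ∑ k ∈ Finset.range 22, deltaCoeff i k * basisCoeff k j = if i = j then 24 else 0 := by
  decide +kernel

/-- The matrix of the coordinates of the images of the representatives. -/
def deltaMatrix : Matrix (Fin 22) (Fin 22) ℚ := .of fun i k => (deltaCoeff i k : ℚ)

/-- The inverse matrix. -/
def basisMatrix : Matrix (Fin 22) (Fin 22) ℚ := .of fun k i => (basisCoeff k i : ℚ) / 24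

theorem deltaMatrix_mul_basisMatrix : deltaMatrix * basisMatrix = 1 := by
  ext i j
  have h := congrArg (Int.cast : ℤ → ℚ) (sum_deltaCoeff_mul_basisCoeff i j)
  rw [Finset.sum_range] at h
  simp only [Matrix.mul_apply, deltaMatrix, basisMatrix, Matrix.of_apply, ← mul_div_assoc,
    ← Finset.sum_div]
  push_cast at h
  rw [h, Matrix.one_apply]
  split_ifs <;> norm_num

theorem basisMatrix_mul_deltaMatrix : basisMatrix * deltaMatrix = 1 :=
  mul_eq_one_comm.1 deltaMatrix_mul_basisMatrix

theorem coord_sum_smul_deltaCoset (r : Fin 22 → ℚ) (k : Fin 22) :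
    (∑ i, r i • deltaCoset (rep i)).coord k = Matrix.vecMul r deltaMatrix k := by
  have h : ∑ i, r i • deltaCoset (rep i) =
      ofVec (∑ i, r i • fun k : ℕ => (deltaCoeff i k : ℚ)) := by
    rw [← ofVecLinear_apply, map_sum]
    refine Finset.sum_congr rfl fun i _ => ?_
    rw [map_smul, ofVecLinear_apply, deltaCoset_rep]
  rw [h, coord_ofVec _ k.2]
  simp [Matrix.vecMul, dotProduct, deltaMatrix]

theorem deltaCoset_linearIndependent {r : Fin 22 → ℚ}
    (h : ∑ i, r i • deltaCoset (rep i) = 0) : r = 0 := by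
  have h' : Matrix.vecMul r deltaMatrix = 0 := by
    ext k
    rw [← coord_sum_smul_deltaCoset, h]
    obtain ⟨k, hk⟩ := k
    interval_cases k <;> rfl
  rw [← Matrix.vecMul_one r, ← deltaMatrix_mul_basisMatrix, ← Matrix.vecMul_vecMul, h',
    Matrix.zero_vecMul]

theorem sum_basisMatrix_smul_deltaCoset (a : PeirceAlg) :
    ∑ i, Matrix.vecMul (fun k : Fin 22 => a.coord k) basisMatrix i • deltaCoset (rep i) = a := by
  rw [← ofVec_coord a, ← ofVec_coord (∑ i, _)]
  refine ofVec_congr fun k hk => ?_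
  rw [ofVec_coord]
  refine (coord_sum_smul_deltaCoset _ ⟨k, hk⟩).trans ?_
  rw [Matrix.vecMul_vecMul, basisMatrix_mul_deltaMatrix, Matrix.vecMul_one]

/-! ### The algebra isomorphism -/

/-- The images of the representatives generate the image of the double Burnside algebra, over a
coefficient ring inside `ℚ`. -/
theorem exists_eq_sum_smul_cls (R : Type) [CommRing R] (x : DoubleBurnside R S₃) :
    ∃ r : Fin 22 → R, ∑ i, r i • DoubleBurnside.cls R (Biset.coset (rep i)) = x := by
  rw [← Submodule.mem_span_range_iff_exists_fun,
    DoubleBurnside.span_range_eq_top R rep exists_eq_pairConj_rep]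
  trivial

/-- The morphism from the double Burnside algebra of `S₃` to `A` that maps `[M]` to `δ([M])`. -/
def toPeirce (R : Type) [CommRing R] [Algebra R PeirceAlg] : DoubleBurnside R S₃ →ₐ[R] PeirceAlg :=
  DoubleBurnside.orbitSumAlgHom R isMackey_deltaCoset

theorem toPeirce_coset (R : Type) [CommRing R] [Algebra R PeirceAlg] (U : Subgroup (S₃ × S₃)) :
    toPeirce R (DoubleBurnside.cls R (Biset.coset U)) = deltaCoset U := by
  rw [toPeirce, DoubleBurnside.orbitSumAlgHom_cls, Biset.orbitSum_coset isMackey_deltaCoset]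

/-- The 22 classes span over R and their images are independent over ℚ. No basis of the double
Burnside algebra has to be known beforehand. -/
theorem toPeirce_injective (R : Type) [CommRing R] [Algebra R PeirceAlg] (ρ : R →+* ℚ)
    (hρ : Function.Injective ρ) (hsmul : ∀ (r : R) (a : PeirceAlg), r • a = ρ r • a) :
    Function.Injective (toPeirce R) := by
  rw [injective_iff_map_eq_zero]
  intro x hx
  obtain ⟨r, rfl⟩ := exists_eq_sum_smul_cls R x
  simp only [map_sum, map_smul, toPeirce_coset, hsmul] at hx
  have h := deltaCoset_linearIndependent hx
  refine Finset.sum_eq_zero fun i _ => ?_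
  rw [(map_eq_zero_iff ρ hρ).1 (congrFun h i), zero_smul]

theorem toPeirce_bijective : Function.Bijective (toPeirce ℚ) := by
  refine ⟨toPeirce_injective ℚ (RingHom.id ℚ) Function.injective_id fun _ _ => rfl, fun a => ?_⟩
  refine ⟨∑ i, Matrix.vecMul (fun k : Fin 22 => a.coord k) basisMatrix i •
    DoubleBurnside.cls ℚ (Biset.coset (rep i)), ?_⟩
  simp only [map_sum, map_smul, toPeirce_coset]
  exact sum_basisMatrix_smul_deltaCoset a

/-- The isomorphism `γ`. -/
def gamma : PeirceAlg ≃ₐ[ℚ] DoubleBurnside ℚ S₃ :=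
  ((AlgEquiv.ofBijective (toPeirce ℚ) toPeirce_bijective).trans
    (MulSemiringAction.toAlgEquiv ℚ PeirceAlg
      (ConjAct.toConjAct (x₁ * x₂ * x₃)))).symm

theorem gamma_symm_apply (y : DoubleBurnside ℚ S₃) :
    gamma.symm y = ↑(x₁ * x₂ * x₃) * toPeirce ℚ y * ↑(x₁ * x₂ * x₃)⁻¹ := by
  rw [gamma, AlgEquiv.symm_symm, AlgEquiv.trans_apply, AlgEquiv.ofBijective_apply,
    MulSemiringAction.toAlgEquiv_apply, ConjAct.units_smul_def, ConjAct.ofConjAct_toConjAct]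

/-- The conjugation built into `gamma` cancels the one in the definition of `delta`. -/
theorem delta_gamma (y : DoubleBurnside ℤ S₃) : delta gamma y =
    toPeirce ℚ (DoubleBurnside.mapCoeff (Int.castRingHom ℚ) S₃ y) := by
  rw [delta_apply, gamma_symm_apply]
  simp [mul_assoc]

theorem delta_gamma_cls (M : Biset S₃) : delta gamma (DoubleBurnside.cls ℤ M) =
    Biset.orbitSum deltaCoset M := by
  rw [delta_gamma, DoubleBurnside.mapCoeff_cls, toPeirce, DoubleBurnside.orbitSumAlgHom_cls]

/-! ### The localization of the image of `δ` -/

/-- Λ is the ℤ-span of the 22 images, so its localization is their ℤ_(3)-span. -/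
theorem mem_LambdaLoc {a : PeirceAlg} : a ∈ LambdaLoc gamma ↔
    ∃ r : Fin 22 → Z₃, ∑ i, (r i : ℚ) • deltaCoset (rep i) = a := by
  have hd : ∀ i, deltaCoset (rep i) ∈ (Lambda gamma : Set PeirceAlg) := fun i =>
    ⟨DoubleBurnside.cls ℤ (Biset.coset (rep i)), by
      rw [delta_gamma_cls, Biset.orbitSum_coset isMackey_deltaCoset]⟩
  have h : a ∈ LambdaLoc gamma ↔
      a ∈ Submodule.span Z₃ (Set.range fun i => deltaCoset (rep i)) := by
    change a ∈ Submodule.span Z₃ (Lambda gamma : Set PeirceAlg) ↔ _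
    refine ⟨fun h => Submodule.span_le.2 ?_ h, fun h => Submodule.span_mono ?_ h⟩
    · rintro _ ⟨y, rfl⟩
      obtain ⟨r, rfl⟩ := exists_eq_sum_smul_cls ℤ y
      rw [map_sum]
      refine sum_mem fun i _ => ?_
      rw [Algebra.smul_def, map_mul, eq_intCast, map_intCast, ← zsmul_eq_mul, delta_gamma_cls,
        Biset.orbitSum_coset isMackey_deltaCoset]
      exact zsmul_mem (Submodule.subset_span (Set.mem_range_self i)) _
    · rintro _ ⟨i, rfl⟩
      exact hd i
  rw [h, Submodule.mem_span_range_iff_exists_fun]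
  rfl

theorem intCast_mem_Z₃ (n : ℤ) : (n : ℚ) ∈ Z₃ := intCast_mem Z₃ n

theorem inv_eight_mem_Z₃ : (8⁻¹ : ℚ) ∈ Z₃ := by
  change ¬ 3 ∣ (8⁻¹ : ℚ).den
  norm_num

theorem ofVec_mem_order {v : ℕ → ℚ} (h : ∀ k < 22, v k ∈ Z₃) : ofVec v ∈ order := by
  refine ⟨fun i j => ?_, fun i => ?_, h 12 (by norm_num), h 13 (by norm_num), h 14 (by norm_num),
    fun i => ?_, h 18 (by norm_num), h 19 (by norm_num), h 20 (by norm_num), h 21 (by norm_num)⟩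
  · fin_cases i <;> fin_cases j <;> exact h _ (by norm_num)
  · fin_cases i <;> exact h _ (by norm_num)
  · fin_cases i <;> exact h _ (by norm_num)

theorem coord_mem_of_mem_order {a : PeirceAlg} (h : a ∈ order) (k : ℕ) (hk : k < 22) :
    a.coord k ∈ Z₃ := by
  obtain ⟨hs, ht, hu, hv, hw, hx, hy, hz, hz', hz''⟩ := h
  interval_cases k
  exacts [hs 0 0, hs 0 1, hs 0 2, hs 1 0, hs 1 1, hs 1 2, hs 2 0, hs 2 1, hs 2 2, ht 0, ht 1, ht 2,
    hu, hv, hw, hx 0, hx 1, hx 2, hy, hz, hz', hz'']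

/-- The numbers 15, 16, 17 and 20 are those of the coordinates x₁, x₂, x₃ and z₂. This gives the
necessity of the congruences, and the complementary `basisCoeff_dvd` their sufficiency. -/
theorem deltaCoeff_dvd : ∀ k ∈ [15, 16, 17, 20], ∀ i < 22, 3 ∣ deltaCoeff i k := by
  decide +kernel

theorem basisCoeff_dvd : ∀ k < 22, k ∉ [15, 16, 17, 20] → ∀ i < 22, 3 ∣ basisCoeff k i := by
  decide +kernel

theorem zeroModThree_coord (r : Fin 22 → Z₃) (k : Fin 22) (hk : (k : ℕ) ∈ [15, 16, 17, 20]) :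
    ZeroModThree ((∑ i, (r i : ℚ) • deltaCoset (rep i)).coord k) := by
  rw [coord_sum_smul_deltaCoset]
  choose q hq using fun i : Fin 22 => deltaCoeff_dvd k hk i i.2
  refine ⟨∑ i, (r i : ℚ) * (q i : ℚ), sum_mem fun i _ => mul_mem (r i).2 (intCast_mem_Z₃ _), ?_⟩
  change ∑ i, (r i : ℚ) * deltaMatrix i k = _
  rw [Finset.mul_sum]
  refine Finset.sum_congr rfl fun i _ => ?_
  rw [deltaMatrix, Matrix.of_apply, hq]
  push_cast
  ring

theorem mem_LambdaLoc_iff (a : PeirceAlg) : a ∈ LambdaLoc gamma ↔ a ∈ order ∧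
    ZeroModThree (a.x 0) ∧ ZeroModThree (a.x 1) ∧ ZeroModThree (a.x 2) ∧
    ZeroModThree a.z.snd.1 := by
  rw [mem_LambdaLoc]
  constructor
  · rintro ⟨r, rfl⟩
    refine ⟨?_, zeroModThree_coord r 15 (by decide), zeroModThree_coord r 16 (by decide),
      zeroModThree_coord r 17 (by decide), zeroModThree_coord r 20 (by decide)⟩
    rw [← ofVec_coord (∑ i, _)]
    refine ofVec_mem_order fun k hk => ?_
    rw [coord_sum_smul_deltaCoset _ ⟨k, hk⟩]
    exact sum_mem fun i _ => mul_mem (r i).2 (intCast_mem_Z₃ _)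
  · rintro ⟨ho, h0, h1, h2, h3⟩
    -- The factor 3 of 24 = 3 · 8 is absorbed by the coordinate in the four special positions, and
    -- by the entry of the inverse matrix in all others.
    have hc : ∀ i k : Fin 22, a.coord k * basisMatrix k i ∈ Z₃ := by
      intro i k
      rw [basisMatrix, Matrix.of_apply]
      by_cases hk : (k : ℕ) ∈ [15, 16, 17, 20]
      · obtain ⟨q, hq, hqk⟩ : ZeroModThree (a.coord k) := by
          simp only [List.mem_cons, List.not_mem_nil, or_false] at hk
          rcases hk with hk | hk | hk | hk <;> rw [hk]
          exacts [h0, h1, h2, h3]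
        have h : a.coord k * ((basisCoeff k i : ℚ) / 24) = q * (basisCoeff k i * 8⁻¹) := by
          rw [hqk]
          ring
        rw [h]
        exact mul_mem hq (mul_mem (intCast_mem_Z₃ _) inv_eight_mem_Z₃)
      · obtain ⟨q, hq⟩ := basisCoeff_dvd k k.2 hk i i.2
        have h : a.coord k * ((basisCoeff k i : ℚ) / 24) = a.coord k * (q * 8⁻¹) := by
          rw [hq]
          push_cast
          ring
        rw [h]
        exact mul_mem (coord_mem_of_mem_order ho k k.2)
          (mul_mem (intCast_mem_Z₃ _) inv_eight_mem_Z₃)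
    exact ⟨fun i => ⟨Matrix.vecMul (fun k : Fin 22 => a.coord k) basisMatrix i,
      sum_mem fun k _ => hc i k⟩, sum_basisMatrix_smul_deltaCoset a⟩

theorem toPeirce_mem_LambdaLoc (x : DoubleBurnside Z₃ S₃) :
    toPeirce Z₃ x ∈ LambdaLoc gamma := by
  obtain ⟨r, rfl⟩ := exists_eq_sum_smul_cls Z₃ x
  refine mem_LambdaLoc.2 ⟨r, ?_⟩
  simp only [map_sum, map_smul, toPeirce_coset]
  rfl

/-- The isomorphism between `B_R(S₃, S₃)` and the localization of the image of `δ`. -/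
def toLambdaLoc : DoubleBurnside Z₃ S₃ ≃ₐ[Z₃] LambdaLoc gamma :=
  AlgEquiv.ofBijective ((toPeirce Z₃).codRestrict (LambdaLoc gamma) toPeirce_mem_LambdaLoc) <| by
    constructor
    · rw [AlgHom.injective_codRestrict]
      exact toPeirce_injective Z₃ Z₃.subtype Subtype.val_injective fun _ _ => rfl
    · rintro ⟨a, ha⟩
      obtain ⟨r, rfl⟩ := mem_LambdaLoc.1 ha
      refine ⟨∑ i, r i • DoubleBurnside.cls Z₃ (Biset.coset (rep i)), Subtype.ext ?_⟩
      change toPeirce Z₃ _ = _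
      simp only [map_sum, map_smul, toPeirce_coset]
      rfl

theorem toLambdaLoc_cls (M : Biset S₃) : (toLambdaLoc (DoubleBurnside.cls Z₃ M) : PeirceAlg) =
    delta gamma (DoubleBurnside.cls ℤ M) := by
  rw [delta_gamma_cls]
  exact DoubleBurnside.orbitSumAlgHom_cls Z₃ isMackey_deltaCoset M

end S₃

end

noncomputable section

namespace S₃

open PeirceAlg

/-! ### The subgroups in the definition of `γ` as representatives -/

theorem mem_V₀ (σ : S₃) : σ ∈ V₀ ↔ bit 1 (code σ) = 1 := by
  rw [V₀, Subgroup.mem_bot]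
  revert σ
  decide +kernel

/-- With bounded exponents, membership can be decided by evaluation. -/
theorem mem_zpowers_iff {σ τ : S₃} {n : ℕ} (hn : n ≠ 0) (hσ : σ ^ n = 1) :
    τ ∈ Subgroup.zpowers σ ↔ ∃ k < n, σ ^ k = τ := by
  constructor
  · rintro ⟨k, rfl⟩
    have h0 : (n : ℤ) ≠ 0 := by exact_mod_cast hn
    refine ⟨(k % n).toNat, ?_, ?_⟩
    · have := Int.emod_lt_of_pos k (by omega : (0 : ℤ) < n)
      have := Int.emod_nonneg k h0
      omega
    · rw [← zpow_natCast, Int.toNat_of_nonneg (Int.emod_nonneg k h0)]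
      change _ = σ ^ k
      conv_rhs => rw [← Int.emod_add_mul_ediv k n, zpow_add, zpow_mul, zpow_natCast, hσ]
      simp
  · rintro ⟨k, -, rfl⟩
    exact pow_mem (Subgroup.mem_zpowers σ) k

theorem mem_V₁ (σ : S₃) : σ ∈ V₁ ↔ bit 3 (code σ) = 1 := by
  rw [V₁, mem_zpowers_iff two_ne_zero (by decide +kernel)]
  revert σ
  decide +kernel

theorem mem_V₄ (σ : S₃) : σ ∈ V₄ ↔ bit 21 (code σ) = 1 := by
  rw [V₄, mem_zpowers_iff three_ne_zero (by decide +kernel)]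
  revert σ
  decide +kernel

theorem mem_V₅ (σ : S₃) : σ ∈ V₅ ↔ bit 63 (code σ) = 1 := by
  simp only [V₅, Subgroup.mem_top, true_iff]
  revert σ
  decide +kernel

theorem toPeirce_H {P Q : Subgroup S₃} {m n : ℕ} (hP : ∀ σ, σ ∈ P ↔ bit m (code σ) = 1)
    (hQ : ∀ σ, σ ∈ Q ↔ bit n (code σ) = 1) (i : Fin 22)
    (h : ∀ x < 6, ∀ y < 6, bit m x = 1 ∧ bit n y = 1 ↔ bit (mask i) (6 * x + y) = 1) :
    toPeirce ℚ (H P Q) = ofVec fun k => deltaCoeff i k := by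
  have hi : P.prod Q = rep i := by
    ext ⟨σ, τ⟩
    rw [Subgroup.mem_prod, hP, hQ, mem_rep]
    exact h _ (code_lt σ) _ (code_lt τ)
  rw [H, toPeirce_coset, hi, deltaCoset_rep]

theorem toPeirce_HΔ {P : Subgroup S₃} {m : ℕ} (hP : ∀ σ, σ ∈ P ↔ bit m (code σ) = 1) (i : Fin 22)
    (h : ∀ x < 6, ∀ y < 6, bit m x = 1 ∧ x = y ↔ bit (mask i) (6 * x + y) = 1) :
    toPeirce ℚ (HΔ P) = ofVec fun k => deltaCoeff i k := by
  have hi : P.map ((MonoidHom.id S₃).prod (MonoidHom.id S₃)) = rep i := by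
    ext ⟨σ, τ⟩
    rw [mem_rep, ← h _ (code_lt σ) _ (code_lt τ), ← hP, code_injective.eq_iff, Subgroup.mem_map]
    constructor
    · rintro ⟨ρ, hρ, hρ'⟩
      obtain ⟨rfl, rfl⟩ := Prod.ext_iff.1 hρ'
      exact ⟨hρ, rfl⟩
    · rintro ⟨hσ, rfl⟩
      exact ⟨σ, hσ, rfl⟩
  rw [HΔ, toPeirce_coset, hi, deltaCoset_rep]

/-- The hypotheses let each element be written as a product of powers of generators: equal parities
make the part in ⟨a⟩ × ⟨a⟩ a power of (a, a), and a nontrivial power of `b` in one entry occurs only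
if (b, 1), at position 12, or (1, b), at position 2, is available. -/
theorem closure_eq_rep {s : Set (S₃ × S₃)} (i : Fin 22) (hs : ∀ p ∈ s, p ∈ rep i)
    (ha : (a, a) ∈ s) (h : ∀ x < 6, ∀ y < 6, bit (mask i) (6 * x + y) = 1 → x % 2 = y % 2)
    (h' : ∀ x < 6, ∀ y < 6, bit (mask i) (6 * x + y) = 1 → x / 2 = 0 ∨ bit (mask i) 12 = 1)
    (h'' : ∀ x < 6, ∀ y < 6, bit (mask i) (6 * x + y) = 1 → y / 2 = 0 ∨ bit (mask i) 2 = 1)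
    (hb : bit (mask i) 12 = 1 → (b, 1) ∈ s) (hb' : bit (mask i) 2 = 1 → (1, b) ∈ s) :
    Subgroup.closure s = rep i := by
  refine le_antisymm ((Subgroup.closure_le _).2 hs) ?_
  rintro ⟨σ, τ⟩ hm
  have hxy := h _ (code_lt σ) _ (code_lt τ) hm
  have hx := h' _ (code_lt σ) _ (code_lt τ) hm
  have hy := h'' _ (code_lt σ) _ (code_lt τ) hm
  have hp : (σ, τ) = (b, 1) ^ (code σ / 2) * (1, b) ^ (code τ / 2) * (a, a) ^ (code σ % 2) := by
    rw [Prod.pow_mk, Prod.pow_mk, Prod.pow_mk, Prod.mk_mul_mk, Prod.mk_mul_mk, one_pow, one_pow,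
      mul_one, one_mul]
    nth_rw 2 [hxy]
    exact Prod.ext (elt_code σ).symm (elt_code τ).symm
  rw [hp]
  refine mul_mem (mul_mem ?_ ?_) (pow_mem (Subgroup.subset_closure ha) _)
  · rcases hx with hx | hx
    · rw [hx, pow_zero]
      exact one_mem _
    · exact pow_mem (Subgroup.subset_closure (hb hx)) _
  · rcases hy with hy | hy
    · rw [hy, pow_zero]
      exact one_mem _
    · exact pow_mem (Subgroup.subset_closure (hb' hy)) _

theorem toPeirce_H₆ : toPeirce ℚ H₆ = ofVec fun k => deltaCoeff 19 k := by
  rw [H₆, toPeirce_coset, closure_eq_rep 19, deltaCoset_rep]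
  · rfl
  · rintro p (rfl | rfl) <;> rw [mem_rep] <;> decide +kernel
  · simp
  · decide +kernel
  · decide +kernel
  · decide +kernel
  · exact fun h => absurd h (by decide +kernel)
  · simp

theorem toPeirce_H₇ : toPeirce ℚ H₇ = ofVec fun k => deltaCoeff 20 k := by
  rw [H₇, toPeirce_coset, closure_eq_rep 20, deltaCoset_rep]
  · rfl
  · rintro p (rfl | rfl) <;> rw [mem_rep] <;> decide +kernel
  · simp
  · decide +kernel
  · decide +kernel
  · decide +kernel
  · simp
  · exact fun h => absurd h (by decide +kernel)

theorem toPeirce_H₈ : toPeirce ℚ H₈ = ofVec fun k => deltaCoeff 21 k := by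
  rw [H₈, toPeirce_coset, closure_eq_rep 21, deltaCoset_rep]
  · rfl
  · rintro p (rfl | rfl | rfl) <;> rw [mem_rep] <;> decide +kernel
  · simp
  · decide +kernel
  · decide +kernel
  · decide +kernel
  · simp
  · simp

/-! ### Comparison with the given formula for γ -/

theorem ofVec_neg (v : ℕ → ℚ) : -ofVec v = ofVec (-v) := by
  rw [← neg_one_smul ℚ, ofVec_smul, neg_one_smul]

theorem ofVec_sub (u v : ℕ → ℚ) : ofVec u - ofVec v = ofVec (u - v) := by
  rw [sub_eq_add_neg, ofVec_neg, ofVec_add, sub_eq_add_neg]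

theorem units_val : ((x₁ * x₂ * x₃ : PeirceAlgˣ) : PeirceAlg) = ofVec fun k =>
    [0, -2, 0, 6, -22, -4, 0, 7, 1, 0, -4, 1, 1, 0, 1, 0, 0, 6, 0, 1, 0, 0].getD k 0 := by
  rw [← ofVec_coord (x₁ * x₂ * x₃ : PeirceAlgˣ)]
  refine ofVec_congr fun k hk => ?_
  interval_cases k <;> (simp [coord, x₁, x₂, x₃]; try norm_num)

/-- The images under `γ` of the standard basis of `A`. -/
def gammaBasis : Fin 22 → DoubleBurnside ℚ S₃ :=
  ![elt_e, b_e_g, b_e_h, b_g_e, elt_g, b_g_h, b_h_e, b_h_g, elt_h, b_e_ε₄, b_g_ε₄, b_h_ε₄, ε₂,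
    b_ε₂_ε₄, ε₃, b_ε₄_e, b_ε₄_g, b_ε₄_h, b_ε₄_ε₂, ε₄, b_ε₄_ε₄', b_ε₄_ε₄'']

theorem gammaFun_eq_sum (c : PeirceAlg) : gammaFun c = ∑ l : Fin 22, c.coord l • gammaBasis l := by
  simp only [Fin.sum_univ_castSucc, Fin.sum_univ_zero, zero_add]
  rfl

theorem sum_coord_smul (c : PeirceAlg) :
    ∑ l : Fin 22, c.coord l • ofVec (fun k => if k = l then 1 else 0) = c := by
  simp only [← ofVecLinear_apply, ← map_smul, ← map_sum]
  conv_rhs => rw [← ofVec_coord c]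
  refine ofVec_congr fun k hk => ?_
  rw [Finset.sum_apply, Finset.sum_eq_single ⟨k, hk⟩]
  · simp
  · intro l _ hl
    have : k ≠ l := fun h => hl (Fin.ext h.symm)
    simp [this]
  · simp

/-- That `gamma` sends a standard basis element to the prescribed element of the double Burnside
algebra is stated here as an intertwining relation, which requires no inverse of the units and
reduces to identities between explicit rational vectors. -/
theorem units_mul_toPeirce_gammaBasis (l : Fin 22) :
    ↑(x₁ * x₂ * x₃) * toPeirce ℚ (gammaBasis l) =
      ofVec (fun k => if k = l then 1 else 0) * ↑(x₁ * x₂ * x₃) := by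
  have e00 := toPeirce_H mem_V₀ mem_V₀ 0 (by decide +kernel)
  have e01 := toPeirce_H mem_V₀ mem_V₁ 1 (by decide +kernel)
  have e04 := toPeirce_H mem_V₀ mem_V₄ 2 (by decide +kernel)
  have e05 := toPeirce_H mem_V₀ mem_V₅ 3 (by decide +kernel)
  have e10 := toPeirce_H mem_V₁ mem_V₀ 4 (by decide +kernel)
  have e11 := toPeirce_H mem_V₁ mem_V₁ 5 (by decide +kernel)
  have e14 := toPeirce_H mem_V₁ mem_V₄ 6 (by decide +kernel)
  have e15 := toPeirce_H mem_V₁ mem_V₅ 7 (by decide +kernel)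
  have e40 := toPeirce_H mem_V₄ mem_V₀ 8 (by decide +kernel)
  have e41 := toPeirce_H mem_V₄ mem_V₁ 9 (by decide +kernel)
  have e44 := toPeirce_H mem_V₄ mem_V₄ 10 (by decide +kernel)
  have e45 := toPeirce_H mem_V₄ mem_V₅ 11 (by decide +kernel)
  have e50 := toPeirce_H mem_V₅ mem_V₀ 12 (by decide +kernel)
  have e51 := toPeirce_H mem_V₅ mem_V₁ 13 (by decide +kernel)
  have e54 := toPeirce_H mem_V₅ mem_V₄ 14 (by decide +kernel)
  have e55 := toPeirce_H mem_V₅ mem_V₅ 15 (by decide +kernel)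
  have d1 := toPeirce_HΔ mem_V₁ 16 (by decide +kernel)
  have d4 := toPeirce_HΔ mem_V₄ 17 (by decide +kernel)
  have d5 := toPeirce_HΔ mem_V₅ 18 (by decide +kernel)
  rw [units_val]
  fin_cases l
  all_goals
    simp only [gammaBasis, Matrix.cons_val, Fin.isValue, Fin.zero_eta, Fin.mk_one, Fin.reduceFinMk]
    simp only [elt_e, b_e_g, b_e_h, b_g_e, elt_g, b_g_h, b_h_e, b_h_g, elt_h, b_e_ε₄, b_g_ε₄, b_h_ε₄,
      ε₂, b_ε₂_ε₄, ε₃, b_ε₄_e, b_ε₄_g, b_ε₄_h, b_ε₄_ε₂, ε₄, b_ε₄_ε₄', b_ε₄_ε₄'']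
    simp only [map_add, map_sub, map_neg, map_smul, e00, e01, e04, e05, e10, e11, e14, e15, e40,
      e41, e44, e45, e50, e51, e54, e55, d1, d4, d5, toPeirce_H₆, toPeirce_H₇, toPeirce_H₈]
    simp only [ofVec_smul, ofVec_add, ofVec_sub, ofVec_neg, ofVec_mul]
    exact ofVec_congr (by decide +kernel)

theorem units_mul_toPeirce_gammaFun (c : PeirceAlg) :
    ↑(x₁ * x₂ * x₃) * toPeirce ℚ (gammaFun c) = c * ↑(x₁ * x₂ * x₃) := by
  conv_rhs => rw [← sum_coord_smul c]
  rw [gammaFun_eq_sum, map_sum, Finset.mul_sum, Finset.sum_mul]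
  refine Finset.sum_congr rfl fun l _ => ?_
  rw [map_smul, mul_smul_comm, units_mul_toPeirce_gammaBasis, smul_mul_assoc]

theorem gamma_apply (c : PeirceAlg) : gamma c = gammaFun c := by
  rw [← AlgEquiv.eq_symm_apply, gamma_symm_apply, units_mul_toPeirce_gammaFun,
    Units.mul_inv_cancel_right]

end S₃

end

theorem corollary5p5 :
    ∃ γ : PeirceAlg ≃ₐ[ℚ] DoubleBurnside ℚ S₃,
      (∀ a : PeirceAlg, γ a = S₃.gammaFun a) ∧
      (∀ a : PeirceAlg, a ∈ PeirceAlg.LambdaLoc γ ↔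
        a ∈ PeirceAlg.order ∧
        ZeroModThree (a.x 0) ∧ ZeroModThree (a.x 1) ∧ ZeroModThree (a.x 2) ∧
        ZeroModThree a.z.snd.1) ∧
      ∃ φ : DoubleBurnside Z₃ S₃ ≃ₐ[Z₃] PeirceAlg.LambdaLoc γ,
        ∀ M : Biset S₃, (φ (DoubleBurnside.cls Z₃ M) : PeirceAlg) =
          PeirceAlg.delta γ (DoubleBurnside.cls ℤ M) :=
  ⟨S₃.gamma, S₃.gamma_apply, S₃.mem_LambdaLoc_iff, S₃.toLambdaLoc, S₃.toLambdaLoc_cls⟩
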